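/- Notation. Let $\mathbb F$ be $\mathbb R$, $\mathbb C$ or $\mathbb H$, let $\mathbb F^m$ be the space of column vectors (a right $\mathbb F$-vector space), $\bar g^t$ the conjugate transpose, $J_n=\begin{pmatrix}0&I_n\\-I_n&0\end{pmatrix}$, $D_n=\begin{pmatrix}0&I_n\\I_n&0\end{pmatrix}$, $I_{p,q}=\begin{pmatrix}I_p&0\\0&-I_q\end{pmatrix}$. For a matrix group $\mathbb G$ put $\theta(g)=(\bar g^t)^{-1}$ and let $\mathbb K=\mathbb G^\theta=\{g\in\mathbb G:\theta(g)=g\}$ be its standard maximal compact subgroup. A subgroup $H$ of a Lie group $K$ is called symmetric if there is an involutive automorphism $\sigma$ of $K$ with $(K^\sigma)_e\subseteq H\subseteq K^\sigma$, where $(\cdot)_e$ is the identity component. Consider the following pairs $(\mathbb G,\mathbb P)$. 1. $\mathbb G=\mathrm{GL}(p+q,\mathbb F)$, $\mathbb F=\mathbb R,\mathbb C,\mathbb H$, $p,q\ge 0$; 2. $\mathbb G=\mathrm{Sp}(2n,\mathbb F)=\{g:g^tJ_ng=J_n\}$, $\mathbb F=\mathbb R,\mathbb C$, $n\geq 0$;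 3. $\mathbb G=\mathrm O(2n,\mathbb C)=\{g:g^tD_ng=D_n\}$ or $\mathbb G=\mathrm{SO}(2n,\mathbb C)=\{g\in \mathrm O(2n,\mathbb C):\det g=1\}$, $n\geq 0$; 4. $\mathbb G=\mathrm U(n,n;\mathbb F)=\{g:\bar g^tD_ng=D_n\}$, $\mathbb F=\mathbb R,\mathbb C,\mathbb H$, $n\geq 0$; 5. $\mathbb G=\mathrm{SO}^*(4n)=\{g\in\mathrm{GL}(2n,\mathbb H):\bar g^tJ_ng=J_n\}$, $n\geq 0$; 6. $\mathbb G=\mathrm{SO}(p+1,q+1)_e$, the identity component of $\{g\in\mathrm{SL}(p+q+2,\mathbb R): g^tI_{p+1,q+1}g=I_{p+1,q+1}\}$, $p+q>2$, $p,q\ge0$; 7. $\mathbb G=\mathrm{SO}(n+2,\mathbb C)=\{g\in\mathrm{SL}(n+2,\mathbb C): g^tg=1\}$, $n\ge 3$. In cases 1–5, $\mathbb P$ is the stabilizer in $\mathbb G$ of the span of the first $p$ (in cases 2–5: the first $n$) standard basis vectors, that is, the subgroup of block upper triangular matrices, and $\mathbb L$ is the subgroup of block diagonal matrices in $\mathbb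 G$. In case 6, $\mathbb P$ is the stabilizer of the line spanned by $e_1+e_{p+2}$, and $\mathbb L$ is the subgroup of those elements of $\mathbb P$ which also stabilize the line spanned by $e_1-e_{p+2}$. In case 7, $\mathbb P$ is the stabilizer of the line spanned by $e_1+ie_2$, and $\mathbb L$ is the subgroup of those elements of $\mathbb P$ which also stabilize the line spanned by $e_1-ie_2$. Proposition. For each of these pairs, $\mathbb K$ is compact and acts transitively on $\mathbb G/\mathbb P$; one has $\mathbb P\cap\mathbb K=\mathbb L\cap\mathbb K$, and this is a symmetric subgroup of $\mathbb K$; and the map $k(\mathbb P\cap\mathbb K)\mapsto k\mathbb P$ is a diffeomorphism $\mathbb K/(\mathbb P\cap\mathbb K)\to\mathbb G/\mathbb P$. Thus $\mathbb G/\mathbb P$ is diffeomorphic to the compact symmetric space $\mathbb K/(\mathbb P\cap\mathbb K)=\mathbb K/(\mathbb L\cap\mathbb K)$. Moreover, for $\mathbb F=\mathbb R,\mathbb C,\mathbb H$ and $p,q\ge0$, let $\mathrm U(m,\mathbb F)=\{g\in \mathrm{GL}(m,\mathbb F):\bar g^tg=1\}$ (so $\mathrm O(m)$, $\mathrm U(m)$,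 $\mathrm{Sp}(m)$), with $\mathrm U(p,\mathbb F)\times\mathrm U(q,\mathbb F)$ embedded block diagonally in $\mathrm U(p+q,\mathbb F)$, and let $\mathrm{Gr}_p(\mathbb F^{p+q})$ be the manifold of $p$-dimensional subspaces of $\mathbb F^{p+q}$. Then sending the class of $k$ to the subspace $k\,\mathbb F^p$, where $\mathbb F^p$ is the span of the first $p$ standard basis vectors, defines a diffeomorphism $$\mathrm U(p+q,\mathbb F)/\bigl(\mathrm U(p,\mathbb F)\times\mathrm U(q,\mathbb F)\bigr)\;\cong\;\mathrm{Gr}_p(\mathbb F^{p+q}).$$ -/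

import Mathlib

open scoped ContDiff Matrix Quaternion

namespace Grassmann

/-! ### Smooth functions and diffeomorphisms

All the spaces below are quotients `π : S → X` of an embedded submanifold `S` of a
finite-dimensional real vector space `E` by a surjective submersion `π`.  Their smooth structure is
encoded by its sheaf of smooth real functions: `f` is smooth on the open set `U ⊆ X` exactly when
`f ∘ π` is smooth on the open subset `π⁻¹ U` of the submanifold `S`. -/

/-- The assignment to every (open) set `U` of the functions which are smooth on `U`. -/
abbrev SmoothFunctions (X : Type*) := Set X → Set (X → ℝ)

/-- The smooth functions on the quotient `π : S → X`, where `emb : S → E` is the inclusion of the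
submanifold `S` into the vector space `E`. -/
def quotientSmooth {S E X : Type*} [NormedAddCommGroup E] [NormedSpace ℝ E]
    (emb : S → E) (π : S → X) : SmoothFunctions X :=
  fun U => {f | ∃ F : E → ℝ, (∀ s, π s ∈ U → F (emb s) = f (π s)) ∧
    ContDiffOn ℝ ∞ F (emb '' (π ⁻¹' U))}

/-- A homeomorphism is a diffeomorphism when it and its inverse pull back
smooth functions on open sets to smooth functions. -/
def IsDiffeo {X Y : Type*} [TopologicalSpace X] [TopologicalSpace Y]
    (smX : SmoothFunctions X) (smY : SmoothFunctions Y) (φ : X ≃ₜ Y) : Prop :=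
  ∀ V : Set Y, IsOpen V → ∀ f : Y → ℝ, f ∈ smY V ↔ f ∘ φ ∈ smX (φ ⁻¹' V)

section Symmetric

/-- `H` is a symmetric subgroup of `K`: there is an involutive automorphism `σ` of the topological
group `K` such that `H` lies between the fixed group of `σ` and its identity component. -/
def IsSymmetricSubgroup {K : Type*} [Group K] [TopologicalSpace K] [IsTopologicalGroup K]
    (H : Subgroup K) : Prop :=
  ∃ σ : K ≃* K, Continuous σ ∧ (∀ k, σ (σ k) = k) ∧
    H ≤ MonoidHom.eqLocus σ.toMonoidHom (MonoidHom.id K) ∧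
    (Subgroup.connectedComponentOfOne
      (MonoidHom.eqLocus σ.toMonoidHom (MonoidHom.id K))).map (Subgroup.subtype _) ≤ H

end Symmetric

section Groups

variable {ι F : Type*} [Fintype ι] [DecidableEq ι]

/-- The general linear group over a (possibly noncommutative) ring. -/
abbrev GLin (ι F : Type*) [Fintype ι] [DecidableEq ι] [Ring F] := (Matrix ι ι F)ˣ

/-- The underlying matrix of an element of a matrix group. -/
def mat [Ring F] {G : Subgroup (GLin ι F)} (g : G) : Matrix ι ι F := ((g : GLin ι F) : Matrix ι ι F)

/-- The stabilizer in `G` of a set `W` of column vectors: the `g` with `g W = W`. -/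
def stab [Ring F] (G : Subgroup (GLin ι F)) (W : Set (ι → F)) : Subgroup G where
  carrier := {g | ∀ x, mat g *ᵥ x ∈ W ↔ x ∈ W}
  one_mem' := by intro x; simp [mat]
  mul_mem' := by
    intro a b ha hb x
    have h : mat (a * b) *ᵥ x = mat a *ᵥ (mat b *ᵥ x) := by simp [mat, Matrix.mulVec_mulVec]
    rw [h]
    exact (ha _).trans (hb _)
  inv_mem' := by
    intro a ha x
    have h : mat a *ᵥ (mat a⁻¹ *ᵥ x) = x := by simp [mat, Matrix.mulVec_mulVec]
    rw [← ha (mat a⁻¹ *ᵥ x), h]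

/-- The standard Cartan involution `θ(g) = (\bar g^t)⁻¹`. -/
def theta [Ring F] [StarRing F] (g : GLin ι F) : GLin ι F := (star g)⁻¹

/-- The maximal compact subgroup `𝕂 = 𝔾^θ`. -/
def maxCompact [Ring F] [StarRing F] (G : Subgroup (GLin ι F)) : Subgroup G where
  carrier := {g | theta (g : GLin ι F) = g}
  one_mem' := by simp [theta]
  mul_mem' := by
    intro a b ha hb
    simp only [Set.mem_ofPred_eq, theta, Subgroup.coe_mul, star_mul, mul_inv_rev] at *
    rw [ha, hb]
  inv_mem' := by
    intro a ha
    simp only [Set.mem_ofPred_eq, theta, Subgroup.coe_inv, star_inv] at *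
    rw [ha]

/-- The group of invertible matrices `g` with `g^t S g = S`. -/
def bilinGroup [CommRing F] (S : Matrix ι ι F) : Subgroup (GLin ι F) where
  carrier := {g | (g : Matrix ι ι F)ᵀ * S * (g : Matrix ι ι F) = S}
  one_mem' := by simp
  mul_mem' := by
    intro a b ha hb
    simp only [Set.mem_ofPred_eq, Units.val_mul, Matrix.transpose_mul] at *
    calc (b : Matrix ι ι F)ᵀ * (a : Matrix ι ι F)ᵀ * S * (a * b : Matrix ι ι F)
        = (b : Matrix ι ι F)ᵀ * ((a : Matrix ι ι F)ᵀ * S * a) * b := by simp only [mul_assoc]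
      _ = S := by rw [ha, hb]
  inv_mem' := by
    intro a ha
    simp only [Set.mem_ofPred_eq] at *
    have h1 : (a : Matrix ι ι F) * (a⁻¹ : GLin ι F) = 1 := a.mul_inv
    have h2 : ((a⁻¹ : GLin ι F) : Matrix ι ι F)ᵀ * (a : Matrix ι ι F)ᵀ = 1 := by
      rw [← Matrix.transpose_mul, h1, Matrix.transpose_one]
    calc ((a⁻¹ : GLin ι F) : Matrix ι ι F)ᵀ * S * (a⁻¹ : GLin ι F)
        = ((a⁻¹ : GLin ι F) : Matrix ι ι F)ᵀ * ((a : Matrix ι ι F)ᵀ * S * a) *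
            (a⁻¹ : GLin ι F) := by rw [ha]
      _ = (((a⁻¹ : GLin ι F) : Matrix ι ι F)ᵀ * (a : Matrix ι ι F)ᵀ) * S *
            (a * (a⁻¹ : GLin ι F)) := by simp only [mul_assoc]
      _ = S := by rw [h1, h2]; simp

/-- The group of invertible matrices `g` with `\bar g^t S g = S`. -/
def sesqGroup [Ring F] [StarRing F] (S : Matrix ι ι F) : Subgroup (GLin ι F) where
  carrier := {g | (g : Matrix ι ι F)ᴴ * S * (g : Matrix ι ι F) = S}
  one_mem' := by simp
  mul_mem' := by
    intro a b ha hb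
    simp only [Set.mem_ofPred_eq, Units.val_mul, Matrix.conjTranspose_mul] at *
    calc (b : Matrix ι ι F)ᴴ * (a : Matrix ι ι F)ᴴ * S * (a * b : Matrix ι ι F)
        = (b : Matrix ι ι F)ᴴ * ((a : Matrix ι ι F)ᴴ * S * a) * b := by simp only [mul_assoc]
      _ = S := by rw [ha, hb]
  inv_mem' := by
    intro a ha
    simp only [Set.mem_ofPred_eq] at *
    have h1 : (a : Matrix ι ι F) * (a⁻¹ : GLin ι F) = 1 := a.mul_inv
    have h2 : ((a⁻¹ : GLin ι F) : Matrix ι ι F)ᴴ * (a : Matrix ι ι F)ᴴ = 1 := by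
      rw [← Matrix.conjTranspose_mul, h1, Matrix.conjTranspose_one]
    calc ((a⁻¹ : GLin ι F) : Matrix ι ι F)ᴴ * S * (a⁻¹ : GLin ι F)
        = ((a⁻¹ : GLin ι F) : Matrix ι ι F)ᴴ * ((a : Matrix ι ι F)ᴴ * S * a) *
            (a⁻¹ : GLin ι F) := by rw [ha]
      _ = (((a⁻¹ : GLin ι F) : Matrix ι ι F)ᴴ * (a : Matrix ι ι F)ᴴ) * S *
            (a * (a⁻¹ : GLin ι F)) := by simp only [mul_assoc]
      _ = S := by rw [h1, h2]; simp

/-- The matrices of determinant one. -/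
def detOne (ι F : Type*) [Fintype ι] [DecidableEq ι] [CommRing F] : Subgroup (GLin ι F) where
  carrier := {g | (g : Matrix ι ι F).det = 1}
  one_mem' := by simp
  mul_mem' := by
    intro a b ha hb
    simp only [Set.mem_ofPred_eq, Units.val_mul, Matrix.det_mul] at *
    rw [ha, hb, one_mul]
  inv_mem' := by
    intro a ha
    simp only [Set.mem_ofPred_eq] at *
    have h : ((a : Matrix ι ι F) * (a⁻¹ : GLin ι F)).det = 1 := by
      rw [a.mul_inv, Matrix.det_one]
    rwa [Matrix.det_mul, ha, one_mul] at h

end Groups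

section Pairs

/-- `J_n`, with `n × n` blocks `0, I, -I, 0`. -/
def formJ (n : ℕ) (F : Type*) [Ring F] : Matrix (Fin n ⊕ Fin n) (Fin n ⊕ Fin n) F :=
  Matrix.fromBlocks 0 1 (-1) 0

/-- `D_n`, with `n × n` blocks `0, I, I, 0`. -/
def formD (n : ℕ) (F : Type*) [Ring F] : Matrix (Fin n ⊕ Fin n) (Fin n ⊕ Fin n) F :=
  Matrix.fromBlocks 0 1 1 0

/-- `I_{p,q}`. -/
def formI (p q : ℕ) (F : Type*) [Ring F] : Matrix (Fin p ⊕ Fin q) (Fin p ⊕ Fin q) F :=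
  Matrix.fromBlocks 1 0 0 (-1)

/-- The span of the first `p` standard basis vectors. -/
def stdFirst (p q : ℕ) (F : Type*) [Ring F] : Set (Fin p ⊕ Fin q → F) :=
  {x | ∀ j, x (Sum.inr j) = 0}

/-- The span of the last `q` standard basis vectors. -/
def stdLast (p q : ℕ) (F : Type*) [Ring F] : Set (Fin p ⊕ Fin q → F) :=
  {x | ∀ i, x (Sum.inl i) = 0}

/-- The block upper triangular elements of `G`, that is, the stabilizer of the standard subspace. -/
def blockParabolic {p q : ℕ} {F : Type*} [Ring F] (G : Subgroup (GLin (Fin p ⊕ Fin q) F)) :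
    Subgroup G :=
  stab G (stdFirst p q F)

/-- The block diagonal elements of `G`. -/
def blockLevi {p q : ℕ} {F : Type*} [Ring F] (G : Subgroup (GLin (Fin p ⊕ Fin q) F)) :
    Subgroup G :=
  stab G (stdFirst p q F) ⊓ stab G (stdLast p q F)

/-- The line spanned by a vector. -/
def line {ι F : Type*} [Ring F] (v : ι → F) : Set (ι → F) := {x | ∃ c : F, x = c • v}

/-- The identity component `SO(p,q)_e` of the group of real matrices of determinant one that
preserve the form `I_{p,q}`. -/
noncomputable def SOIdComponent (p q : ℕ) : Subgroup (GLin (Fin p ⊕ Fin q) ℝ) :=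
  (Subgroup.connectedComponentOfOne
    (bilinGroup (formI p q ℝ) ⊓ detOne (Fin p ⊕ Fin q) ℝ : Subgroup _)).map (Subgroup.subtype _)

/-- The complex special orthogonal group `SO(n+2, ℂ)`, of the form `x₁² + ⋯ + x_{n+2}²`. -/
noncomputable def SOComplex (n : ℕ) : Subgroup (GLin (Fin 2 ⊕ Fin n) ℂ) :=
  bilinGroup 1 ⊓ detOne (Fin 2 ⊕ Fin n) ℂ

/-- The vector `(1, 0, …, 0, c, 0, …, 0)`, with the entries `1` and `c` at the first place of
either block. -/
noncomputable def realIsotropic (p q : ℕ) (c : ℝ) : Fin (p + 1) ⊕ Fin (q + 1) → ℝ :=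
  Sum.elim (Pi.single 0 1) (Pi.single 0 c)

/-- The vector `(1, c, 0, …, 0)`. -/
noncomputable def complexIsotropic (n : ℕ) (c : ℂ) : Fin 2 ⊕ Fin n → ℂ :=
  Sum.elim ![1, c] 0

/-- The stabilizer of the point `(1:0:…:1:0:…:0)` of the real quadric. -/
noncomputable def realQuadricParabolic (p q : ℕ) : Subgroup (SOIdComponent (p + 1) (q + 1)) :=
  stab _ (line (realIsotropic p q 1))

/-- The Levi subgroup: the stabilizer of two opposite isotropic lines. -/
noncomputable def realQuadricLevi (p q : ℕ) : Subgroup (SOIdComponent (p + 1) (q + 1)) :=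
  stab _ (line (realIsotropic p q 1)) ⊓ stab _ (line (realIsotropic p q (-1)))

/-- The stabilizer of the point `(1:i:0:…:0)` of the complex quadric. -/
noncomputable def complexQuadricParabolic (n : ℕ) : Subgroup (SOComplex n) :=
  stab _ (line (complexIsotropic n Complex.I))

/-- The Levi subgroup: the stabilizer of two opposite isotropic lines. -/
noncomputable def complexQuadricLevi (n : ℕ) : Subgroup (SOComplex n) :=
  stab _ (line (complexIsotropic n Complex.I)) ⊓ stab _ (line (complexIsotropic n (-Complex.I)))

end Pairs

section Claims

attribute [local instance] Matrix.normedAddCommGroup Matrix.normedSpace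

variable {ι F : Type*} [Fintype ι] [DecidableEq ι] [NormedRing F] [NormedAlgebra ℝ F]

/-- The smooth structure of `𝔾/H`, with `𝔾` a matrix group. -/
def smoothQuot (G : Subgroup (GLin ι F)) (H : Subgroup G) : SmoothFunctions (G ⧸ H) :=
  quotientSmooth (fun g : G => mat g) (fun g : G => (g : G ⧸ H))

/-- The smooth structure of `K/H`, with `K` a subgroup of a matrix group. -/
def smoothSubQuot {G : Subgroup (GLin ι F)} (K : Subgroup G) (H : Subgroup K) :
    SmoothFunctions (K ⧸ H) :=
  quotientSmooth (fun k : K => mat (k : G)) (fun k : K => (k : K ⧸ H))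

/-- The claim for one pair `(𝔾, ℙ)` with Levi subgroup `𝕃` of `ℙ` and with `𝕂 = 𝔾^θ`:
`𝕂` is compact and transitive on `𝔾/ℙ`, `ℙ ∩ 𝕂 = 𝕃 ∩ 𝕂` is a symmetric subgroup of `𝕂`, and
`k(ℙ ∩ 𝕂) ↦ kℙ` is a diffeomorphism from `𝕂/(ℙ ∩ 𝕂)` to `𝔾/ℙ`. -/
def IsCompactSymmetricRealization [StarRing F] (G : Subgroup (GLin ι F)) (P L : Subgroup G) :
    Prop :=
  IsCompact (maxCompact G : Set G) ∧
  MulAction.IsPretransitive (maxCompact G) (G ⧸ P) ∧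
  P ⊓ maxCompact G = L ⊓ maxCompact G ∧
  IsSymmetricSubgroup (P.subgroupOf (maxCompact G)) ∧
  ∃ φ : (maxCompact G ⧸ P.subgroupOf (maxCompact G)) ≃ₜ (G ⧸ P),
    (∀ k : maxCompact G, φ (k : maxCompact G ⧸ P.subgroupOf (maxCompact G)) = ((k : G) : G ⧸ P)) ∧
    IsDiffeo (smoothSubQuot (maxCompact G) (P.subgroupOf (maxCompact G))) (smoothQuot G P) φ

/-- The claim for a matrix group `𝔾` in two-by-two blocks, with `ℙ` its subgroup of block upper
triangular matrices and `𝕃` its subgroup of block diagonal matrices. -/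
def IsBlockRealization {p q : ℕ} {F : Type*} [NormedRing F] [NormedAlgebra ℝ F] [StarRing F]
    (G : Subgroup (GLin (Fin p ⊕ Fin q) F)) : Prop :=
  IsCompactSymmetricRealization G (blockParabolic G) (blockLevi G)

/-- The unitary group `U(ι, F)`, for `F = ℝ, ℂ, ℍ` the groups `O`, `U`, `Sp`. -/
def unitaryGL (ι F : Type*) [Fintype ι] [DecidableEq ι] [Ring F] [StarRing F] :
    Subgroup (GLin ι F) :=
  sesqGroup 1

/-- `U(p, F) × U(q, F)`, embedded block diagonally in `U(p+q, F)`. -/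
def blockUnitary (p q : ℕ) (F : Type*) [Ring F] [StarRing F] :
    Subgroup (unitaryGL (Fin p ⊕ Fin q) F) where
  carrier := {g | ∃ (a : unitaryGL (Fin p) F) (d : unitaryGL (Fin q) F),
    mat g = Matrix.fromBlocks (mat a) 0 0 (mat d)}
  one_mem' := ⟨1, 1, by simp [mat]⟩
  mul_mem' := by
    rintro g h ⟨a, d, hg⟩ ⟨b, e, hh⟩
    refine ⟨a * b, d * e, ?_⟩
    simp only [mat, Subgroup.coe_mul, Units.val_mul] at *
    rw [hg, hh, Matrix.fromBlocks_multiply]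
    simp
  inv_mem' := by
    rintro g ⟨a, d, hg⟩
    refine ⟨a⁻¹, d⁻¹, ?_⟩
    simp only [mat, Subgroup.coe_inv] at *
    apply Units.inv_eq_of_mul_eq_one_right
    rw [hg, Matrix.fromBlocks_multiply]
    simp

/-- The right `F`-subspaces of dimension `p` of the space `F^{p+q}` of column vectors. -/
def Gr (p q : ℕ) (F : Type*) [Ring F] : Type _ :=
  {W : Submodule Fᵐᵒᵖ (Fin p ⊕ Fin q → F) // Module.finrank Fᵐᵒᵖ W = p}

/-- The `p`-frames in `F^{p+q}`, an open subset of the space of `p`-tuples of vectors. -/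
def Frames (p q : ℕ) (F : Type*) [Ring F] : Type _ :=
  {v : Fin p → (Fin p ⊕ Fin q → F) // LinearIndependent Fᵐᵒᵖ v}

/-- The subspace spanned by a frame. -/
def frameSpan (p q : ℕ) (F : Type*) [Ring F] [Nontrivial F] [StrongRankCondition Fᵐᵒᵖ] (v : Frames p q F) :
    Gr p q F :=
  ⟨Submodule.span Fᵐᵒᵖ (Set.range v.1), by
    rw [finrank_span_eq_card v.2, Fintype.card_fin]⟩

/-- The topology of the Grassmannian, as the quotient of the space of frames. -/
instance (p q : ℕ) (F : Type*) [NormedRing F] [Nontrivial F] [StrongRankCondition Fᵐᵒᵖ] :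
    TopologicalSpace (Gr p q F) :=
  TopologicalSpace.coinduced (frameSpan p q F)
    (TopologicalSpace.induced Subtype.val inferInstance)

/-- The smooth structure of the Grassmannian, as the quotient of the space of frames. -/
def smoothGr (p q : ℕ) (F : Type*) [NormedRing F] [NormedAlgebra ℝ F] [Nontrivial F] [StrongRankCondition Fᵐᵒᵖ] :
    SmoothFunctions (Gr p q F) :=
  quotientSmooth (fun v : Frames p q F => v.1) (frameSpan p q F)

/-- `U(p+q, F)/(U(p, F) × U(q, F))` with its smooth structure is diffeomorphic to `Gr_p(F^{p+q})`,
by the orbit map of the standard subspace. -/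
def IsGrassmannRealization (p q : ℕ) (F : Type*) [NormedRing F] [NormedAlgebra ℝ F] [StarRing F]
    [Nontrivial F] [StrongRankCondition Fᵐᵒᵖ] : Prop :=
  ∃ φ : (unitaryGL (Fin p ⊕ Fin q) F ⧸ blockUnitary p q F) ≃ₜ Gr p q F,
    (∀ k : unitaryGL (Fin p ⊕ Fin q) F,
      ((φ (k : unitaryGL (Fin p ⊕ Fin q) F ⧸ blockUnitary p q F)).1 : Set (Fin p ⊕ Fin q → F)) =
        (fun x => mat k *ᵥ x) '' stdFirst p q F) ∧
    IsDiffeo (smoothQuot (unitaryGL (Fin p ⊕ Fin q) F) (blockUnitary p q F)) (smoothGr p q F) φ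

end Claims

end Grassmann

/-!
All the parabolic subgroups in question are stabilizers of the range of an orthogonal projection `e`
in a `*`-algebra of matrices, and apart from components the ambient groups consist of the `g` with
`τ (star g) = g⁻¹` for at most one `*`-automorphism `τ`, which exchanges `e` with the orthogonal
projection `e'` onto an opposite subspace.  A unitary `k` stabilizes the range of `e` if and only if
it commutes with `e`; if it lies in the group it then commutes with `e' = τ e` as well, which gives
`ℙ ∩ 𝕂 = 𝕃 ∩ 𝕂` and identifies this group with the fixed points, up to components, of conjugation by
a unitary reflection.

For `g` near `1` the range of `g e` has an orthogonal projection depending smoothly on `g`, and so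
has the range of `(star g)⁻¹ e'`; together with the remaining parts they define an element carrying
`e` and `e'` to these projections.  Its unitary polar part is fixed by `τ`, because `τ` exchanges
the two projections, and is congruent to `g` modulo the stabilizer of `e`: it is a smooth local
section with values in `𝕂`, which makes the bijection `𝕂/(ℙ ∩ 𝕂) → 𝔾/ℙ` a diffeomorphism.

It also shows that `𝕂ℙ` is a neighborhood of `1`.  As `𝕂` is compact, the orbit of the base point is
open and closed, so `𝕂ℙ` contains the identity component of `𝔾`.  The polar decomposition of
the group, whose positive factors are joined to `1` inside it, then gives `𝔾 = 𝕂ℙ`.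
-/

namespace Grassmann

open Filter Topology

open scoped Ring

section SmoothQuotients

theorem exists_continuousAt_section {S₁ S₂ E₁ E₂ Y : Type*} [TopologicalSpace S₁]
    [TopologicalSpace S₂] [TopologicalSpace E₁] [TopologicalSpace E₂] {emb₁ : S₁ → E₁}
    {emb₂ : S₂ → E₂} {π : S₂ → Y} {j : S₁ → S₂} (hemb₁ : IsInducing emb₁)
    (hemb₂ : Continuous emb₂) {t₀ : S₂} {κ : E₂ → E₁} (hκ : ContinuousAt κ (emb₂ t₀))
    (hsec : ∀ᶠ x in 𝓝 (emb₂ t₀), ∀ t, emb₂ t = x → ∃ s, emb₁ s = κ x ∧ π (j s) = π t) :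
    ∃ σ : S₂ → S₁, ContinuousAt σ t₀ ∧ ∀ᶠ t in 𝓝 t₀, π (j (σ t)) = π t := by
  have hlift : ∀ᶠ t in 𝓝 t₀, ∃ s, emb₁ s = κ (emb₂ t) ∧ π (j s) = π t :=
    (hemb₂.continuousAt.eventually hsec).mono fun t ht => ht t rfl
  have : Nonempty S₁ := hlift.self_of_nhds.nonempty
  obtain ⟨σ, hσ⟩ := hlift.choice
  refine ⟨σ, hemb₁.continuousAt_iff.2 ?_, hσ.mono fun t ht => ht.2⟩
  exact (ContinuousAt.comp (g := κ) hκ hemb₂.continuousAt).congr (hσ.mono fun t ht => ht.1.symm)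

variable {S₁ S₂ X Y E₁ E₂ : Type*} [NormedAddCommGroup E₁] [NormedSpace ℝ E₁]
  [NormedAddCommGroup E₂] [NormedSpace ℝ E₂] {emb₁ : S₁ → E₁} {emb₂ : S₂ → E₂}
  {π₁ : S₁ → X} {π₂ : S₂ → Y} {j : S₁ → S₂} {φ : X → Y} {V : Set Y} {f : Y → ℝ}

theorem comp_mem_quotientSmooth (hφ : ∀ s, φ (π₁ s) = π₂ (j s)) {J : E₁ → E₂}
    (hJ : ContDiff ℝ ∞ J) (hjJ : ∀ s, emb₂ (j s) = J (emb₁ s))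
    (hf : f ∈ quotientSmooth emb₂ π₂ V) : f ∘ φ ∈ quotientSmooth emb₁ π₁ (φ ⁻¹' V) := by
  obtain ⟨F, hFf, hF⟩ := hf
  have mem_V {s : S₁} (hs : π₁ s ∈ φ ⁻¹' V) : π₂ (j s) ∈ V := hφ s ▸ hs
  refine ⟨F ∘ J, fun s hs => ?_, hF.comp hJ.contDiffOn ?_⟩
  · rw [Function.comp_apply, Function.comp_apply, ← hjJ, hFf _ (mem_V hs), hφ]
  · rintro _ ⟨s, hs, rfl⟩
    exact ⟨j s, mem_V hs, hjJ s⟩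

theorem mem_quotientSmooth_of_local_sections (hemb₂ : Function.Injective emb₂)
    (hφ : ∀ s, φ (π₁ s) = π₂ (j s))
    (hsec : ∀ t₀, ∃ κ : E₂ → E₁, ContDiffAt ℝ ∞ κ (emb₂ t₀) ∧
      ∀ᶠ x in 𝓝 (emb₂ t₀), ∀ t, emb₂ t = x → ∃ s, emb₁ s = κ x ∧ π₂ (j s) = π₂ t)
    (hf : f ∘ φ ∈ quotientSmooth emb₁ π₁ (φ ⁻¹' V)) : f ∈ quotientSmooth emb₂ π₂ V := by
  obtain ⟨F, hFf, hF⟩ := hf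
  let G : E₂ → ℝ := Function.extend emb₂ (f ∘ π₂) 0
  have hG (t : S₂) : G (emb₂ t) = f (π₂ t) := hemb₂.extend_apply _ _ t
  refine ⟨G, fun t _ => hG t, ?_⟩
  rintro _ ⟨t₀, ht₀, rfl⟩
  obtain ⟨κ, hκ, hκ_sec⟩ := hsec t₀
  have hGF : ∀ᶠ x in 𝓝[emb₂ '' (π₂ ⁻¹' V)] (emb₂ t₀),
      κ x ∈ emb₁ '' (π₁ ⁻¹' (φ ⁻¹' V)) ∧ G x = F (κ x) := by
    filter_upwards [nhdsWithin_le_nhds hκ_sec, self_mem_nhdsWithin]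
    rintro _ hx ⟨t, ht, rfl⟩
    obtain ⟨s, hs, hst⟩ := hx t rfl
    have hsV : φ (π₁ s) ∈ V := by rwa [hφ, hst]
    exact ⟨⟨s, hsV, hs⟩, by rw [hG, ← hs, hFf s hsV, Function.comp_apply, hφ, hst]⟩
  have hGF₀ := hGF.self_of_nhdsWithin ⟨t₀, ht₀, rfl⟩
  exact ((hF _ hGF₀.1).comp_of_preimage_mem_nhdsWithin _ hκ.contDiffWithinAt
    (hGF.mono fun _ h => h.1)).congr_of_eventuallyEq (hGF.mono fun _ h => h.2) hGF₀.2

variable [TopologicalSpace S₁] [TopologicalSpace S₂] [TopologicalSpace X] [TopologicalSpace Y]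

theorem exists_homeomorph_of_local_sections (hπ₁ : IsQuotientMap π₁) (hπ₂ : IsQuotientMap π₂)
    (hj : Continuous j) (hfib : ∀ s s', π₁ s = π₁ s' ↔ π₂ (j s) = π₂ (j s'))
    (hsec : ∀ t₀, ∃ σ : S₂ → S₁, ContinuousAt σ t₀ ∧ ∀ᶠ t in 𝓝 t₀, π₂ (j (σ t)) = π₂ t) :
    ∃ φ : X ≃ₜ Y, ∀ s, φ (π₁ s) = π₂ (j s) := by
  let lift : X → Y := fun x => π₂ (j (Function.surjInv hπ₁.surjective x))
  have lift_mk (s : S₁) : lift (π₁ s) = π₂ (j s) :=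
    (hfib _ _).1 (Function.surjInv_eq hπ₁.surjective (π₁ s))
  have injective : Function.Injective lift := by
    intro x y hxy
    obtain ⟨s, rfl⟩ := hπ₁.surjective x
    obtain ⟨s', rfl⟩ := hπ₁.surjective y
    rwa [lift_mk, lift_mk, ← hfib] at hxy
  have surjective : Function.Surjective lift := by
    intro y
    obtain ⟨t, rfl⟩ := hπ₂.surjective y
    obtain ⟨σ, -, hσ⟩ := hsec t
    exact ⟨π₁ (σ t), (lift_mk _).trans hσ.self_of_nhds⟩
  let e : X ≃ Y := Equiv.ofBijective lift ⟨injective, surjective⟩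
  have e_mk : ∀ s, e (π₁ s) = π₂ (j s) := lift_mk
  have continuous_e : Continuous e := by
    rw [hπ₁.continuous_iff, show e ∘ π₁ = π₂ ∘ j from funext e_mk]
    exact hπ₂.continuous.comp hj
  have continuous_symm : Continuous e.symm := by
    rw [hπ₂.continuous_iff, continuous_iff_continuousAt]
    intro t₀
    obtain ⟨σ, hσ_cont, hσ⟩ := hsec t₀
    refine (hπ₁.continuous.continuousAt.comp hσ_cont).congr (hσ.mono fun t ht => ?_)
    rw [Function.comp_apply, Function.comp_apply, Equiv.eq_symm_apply, e_mk, ht]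
  exact ⟨⟨e, continuous_e, continuous_symm⟩, e_mk⟩

theorem exists_isDiffeo_of_local_sections (hemb₁ : IsInducing emb₁) (hemb₂ : Continuous emb₂)
    (hemb₂_inj : Function.Injective emb₂) (hπ₁ : IsQuotientMap π₁) (hπ₂ : IsQuotientMap π₂)
    (hj : Continuous j) {J : E₁ → E₂} (hJ : ContDiff ℝ ∞ J) (hjJ : ∀ s, emb₂ (j s) = J (emb₁ s))
    (hfib : ∀ s s', π₁ s = π₁ s' ↔ π₂ (j s) = π₂ (j s'))
    (hsec : ∀ t₀, ∃ κ : E₂ → E₁, ContDiffAt ℝ ∞ κ (emb₂ t₀) ∧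
      ∀ᶠ x in 𝓝 (emb₂ t₀), ∀ t, emb₂ t = x → ∃ s, emb₁ s = κ x ∧ π₂ (j s) = π₂ t) :
    ∃ φ : X ≃ₜ Y, (∀ s, φ (π₁ s) = π₂ (j s)) ∧
      IsDiffeo (quotientSmooth emb₁ π₁) (quotientSmooth emb₂ π₂) φ := by
  obtain ⟨φ, hφ⟩ := exists_homeomorph_of_local_sections hπ₁ hπ₂ hj hfib fun t₀ =>
    have ⟨_, hκ, hκ_sec⟩ := hsec t₀
    exists_continuousAt_section hemb₁ hemb₂ hκ.continuousAt hκ_sec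
  exact ⟨φ, hφ, fun V _ f => ⟨comp_mem_quotientSmooth hφ hJ hjJ,
    mem_quotientSmooth_of_local_sections hemb₂_inj hφ hsec⟩⟩

end SmoothQuotients

section RingInverse

theorem commute_ringInverse_right {M : Type*} [MonoidWithZero M] {a b : M} (h : Commute a b) :
    Commute a b⁻¹ʳ := by
  by_cases hb : IsUnit b
  · obtain ⟨u, rfl⟩ := hb
    rw [Ring.inverse_unit]
    exact h.units_inv_right
  · rw [Ring.inverse_non_unit _ hb]
    exact Commute.zero_right a

theorem map_ringInverse {M N E : Type*} [MonoidWithZero M] [MonoidWithZero N] [EquivLike E M N]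
    [MulEquivClass E M N] (τ : E) (a : M) : τ a⁻¹ʳ = (τ a)⁻¹ʳ := by
  by_cases ha : IsUnit a
  · refine left_inv_eq_right_inv (a := τ a) ?_
      (Ring.mul_inverse_cancel _ ((MulEquiv.isUnit_map τ).2 ha))
    rw [← map_mul, Ring.inverse_mul_cancel _ ha, map_one]
  · rw [Ring.inverse_non_unit _ ha, map_zero,
      Ring.inverse_non_unit _ (mt (MulEquiv.isUnit_map τ).1 ha)]

end RingInverse

section SquareRoots

variable {A : Type*} [NormedRing A]

theorem eventually_norm_sub_one_lt : ∀ᶠ a in 𝓝 (1 : A), ‖a - 1‖ < 1 := by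
  filter_upwards [Metric.ball_mem_nhds (1 : A) one_pos] with a ha
  rwa [Metric.mem_ball, dist_eq_norm] at ha

theorem eventually_isUnit [CompleteSpace A] : ∀ᶠ a in 𝓝 (1 : A), IsUnit a :=
  Units.isOpen.mem_nhds isUnit_one

theorem tendsto_ringInverse [CompleteSpace A] : Tendsto (fun a : A => a⁻¹ʳ) (𝓝 1) (𝓝 1) := by
  simpa [ContinuousAt] using NormedRing.inverse_continuousAt (1 : Aˣ)

variable [NormedAlgebra ℝ A]

theorem eq_zero_of_mul_add_mul_eq_zero {z d : A} (hz : ‖z - 1‖ < 1) (h : z * d + d * z = 0) :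
    d = 0 := by
  have h2 : (2 : ℝ) • d = -((z - 1) * d + d * (z - 1)) := by
    rw [two_smul, eq_neg_iff_add_eq_zero, ← h]
    noncomm_ring
  have hle : 2 * ‖d‖ ≤ 2 * (‖z - 1‖ * ‖d‖) :=
    calc 2 * ‖d‖ = ‖(z - 1) * d + d * (z - 1)‖ := by rw [← norm_neg (_ + _), ← h2, norm_smul]; simp
      _ ≤ ‖z - 1‖ * ‖d‖ + ‖d‖ * ‖z - 1‖ :=
        (norm_add_le _ _).trans (add_le_add (norm_mul_le _ _) (norm_mul_le _ _))
      _ = 2 * (‖z - 1‖ * ‖d‖) := by ring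
  by_contra hd
  nlinarith [norm_pos_iff.2 hd]

theorem eq_of_mul_self_eq_mul_self {x y : A} (hx : ‖x - 1‖ < 1) (hy : ‖y - 1‖ < 1)
    (h : x * x = y * y) : x = y := by
  have hmid : ‖(2⁻¹ : ℝ) • (x + y) - 1‖ < 1 :=
    calc ‖(2⁻¹ : ℝ) • (x + y) - 1‖ = ‖(2⁻¹ : ℝ) • ((x - 1) + (y - 1))‖ := by
          congr 1; module
      _ ≤ 2⁻¹ * (‖x - 1‖ + ‖y - 1‖) := by
          rw [norm_smul, Real.norm_of_nonneg (by norm_num)]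
          gcongr
          exact norm_add_le _ _
      _ < 1 := by linarith
  refine sub_eq_zero.1 (eq_zero_of_mul_add_mul_eq_zero hmid ?_)
  rw [smul_mul_assoc, mul_smul_comm, ← smul_add,
    show (x + y) * (x - y) + (x - y) * (x + y) = (2 : ℝ) • (x * x - y * y) by
      rw [two_smul]; noncomm_ring, h, sub_self, smul_zero, smul_zero]

theorem commute_of_commute_mul_self {x y : A} (hx : ‖x - 1‖ < 1) (h : Commute y (x * x)) :
    Commute y x := by
  refine sub_eq_zero.1 (eq_zero_of_mul_add_mul_eq_zero hx ?_)
  rw [← sub_eq_zero.2 h.eq]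
  noncomm_ring

variable [CompleteSpace A]

theorem exists_contDiffAt_sqrt (A : Type*) [NormedRing A] [NormedAlgebra ℝ A] [CompleteSpace A] :
    ∃ r : A → A, ContDiffAt ℝ ∞ r 1 ∧ r 1 = 1 ∧ ∀ᶠ a in 𝓝 (1 : A), r a * r a = a := by
  have hsq : ContDiffAt ℝ ∞ (fun x : A => x * x) 1 := contDiffAt_id.mul contDiffAt_id
  let double : A ≃L[ℝ] A := ContinuousLinearEquiv.smulLeft (Units.mk0 (2 : ℝ) two_ne_zero)
  have hderiv : HasFDerivAt (fun x : A => x * x) (double : A →L[ℝ] A) 1 := by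
    convert! (hasFDerivAt_id (𝕜 := ℝ) (1 : A)).mul' (hasFDerivAt_id (𝕜 := ℝ) (1 : A)) using 1
    ext x
    simp [double, two_smul, Units.smul_def]
  have hr := hsq.to_localInverse hderiv (by simp)
  have hr1 := hsq.localInverse_apply_image hderiv (by simp)
  have hinv := (hsq.hasStrictFDerivAt' hderiv (by simp)).eventually_right_inverse
  simp only [mul_one] at hr hr1 hinv
  exact ⟨_, hr, hr1, hinv⟩

/-- A square root on a neighborhood of `1`, with `localSqrt 1 = 1`; it is given by the inverse
function theorem, and its values far from `1` are junk. -/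
noncomputable def localSqrt : A → A := (exists_contDiffAt_sqrt A).choose

theorem contDiffAt_localSqrt : ContDiffAt ℝ ∞ (localSqrt : A → A) 1 :=
  (exists_contDiffAt_sqrt A).choose_spec.1

@[simp]
theorem localSqrt_one : localSqrt (1 : A) = 1 := (exists_contDiffAt_sqrt A).choose_spec.2.1

theorem localSqrt_mul_self : ∀ᶠ a in 𝓝 (1 : A), localSqrt a * localSqrt a = a :=
  (exists_contDiffAt_sqrt A).choose_spec.2.2

theorem tendsto_localSqrt : Tendsto (localSqrt : A → A) (𝓝 1) (𝓝 1) := by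
  simpa using contDiffAt_localSqrt.continuousAt.tendsto (x := (1 : A))

theorem map_localSqrt {τ : A → A} (hτ : Tendsto τ (𝓝 1) (𝓝 1))
    (hmul : ∀ a, τ (a * a) = τ a * τ a) :
    ∀ᶠ a in 𝓝 1, τ a = a → τ (localSqrt a) = localSqrt a := by
  filter_upwards [localSqrt_mul_self, tendsto_localSqrt.eventually eventually_norm_sub_one_lt,
    (hτ.comp tendsto_localSqrt).eventually eventually_norm_sub_one_lt] with a hsq hr hτr ha
  exact eq_of_mul_self_eq_mul_self hτr hr (by rw [← hmul, hsq, ha])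

theorem commute_localSqrt : ∀ᶠ a in 𝓝 (1 : A), ∀ b, Commute b a → Commute b (localSqrt a) := by
  filter_upwards [localSqrt_mul_self, tendsto_localSqrt.eventually eventually_norm_sub_one_lt]
    with a hsq hr b hb
  exact commute_of_commute_mul_self hr (by rwa [hsq])

end SquareRoots

section Polar

variable {A : Type*} [NormedRing A] [StarRing A]

theorem tendsto_star_mul_self [ContinuousStar A] :
    Tendsto (fun u : A => star u * u) (𝓝 1) (𝓝 1) := by
  have h : Continuous fun u : A => star u * u := by fun_prop
  simpa using h.tendsto 1

variable [NormedAlgebra ℝ A]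

theorem contDiffAt_star [ContinuousStar A] [StarModule ℝ A] {a : A} :
    ContDiffAt ℝ ∞ (star : A → A) a :=
  (starL' ℝ : A ≃L[ℝ] A).contDiff.contDiffAt

variable [CompleteSpace A]

theorem star_localSqrt [ContinuousStar A] :
    ∀ᶠ a in 𝓝 (1 : A), star a = a → star (localSqrt a) = localSqrt a :=
  map_localSqrt (by simpa using (continuous_star (R := A)).tendsto 1) fun a => star_mul a a

/-- The unitary factor `u (u* u)^{-1/2}` of the polar decomposition of `u` near `1`. -/
noncomputable def polar (u : A) : A := u * (localSqrt (star u * u))⁻¹ʳ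

@[simp]
theorem polar_one : polar (1 : A) = 1 := by simp [polar]

variable [ContinuousStar A]

theorem contDiffAt_polar [StarModule ℝ A] : ContDiffAt ℝ ∞ (polar : A → A) 1 := by
  have hsq : ContDiffAt ℝ ∞ (fun u : A => star u * u) 1 := contDiffAt_star.mul contDiffAt_id
  have hsqrt : ContDiffAt ℝ ∞ (fun u : A => localSqrt (star u * u)) 1 :=
    ContDiffAt.comp (g := localSqrt) 1 (by simpa using contDiffAt_localSqrt) hsq
  refine contDiffAt_id.mul (ContDiffAt.comp (g := Ring.inverse) 1 ?_ hsqrt)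
  simpa using contDiffAt_ringInverse ℝ (1 : Aˣ)

theorem polar_mem_unitary : ∀ᶠ u in 𝓝 (1 : A), polar u ∈ unitary A := by
  filter_upwards [eventually_isUnit, tendsto_star_mul_self.eventually localSqrt_mul_self,
    tendsto_star_mul_self.eventually star_localSqrt,
    (tendsto_localSqrt.comp tendsto_star_mul_self).eventually eventually_isUnit]
    with u hu hsq hstar hunit
  set r := localSqrt (star u * u) with hr
  have hr_star : star r = r := hstar (by simp)
  have hr_unit : IsUnit r := hunit
  have h : star (polar u) * polar u = 1 :=
    calc star (polar u) * polar u = r⁻¹ʳ * (star u * u) * r⁻¹ʳ := by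
          rw [polar, ← hr, star_mul, ← Ring.inverse_star, hr_star]; simp only [mul_assoc]
      _ = (r⁻¹ʳ * r) * (r * r⁻¹ʳ) := by rw [← hsq]; simp only [mul_assoc]
      _ = 1 := by rw [Ring.inverse_mul_cancel _ hr_unit, Ring.mul_inverse_cancel _ hr_unit, mul_one]
  obtain ⟨v, hv⟩ := hu.mul hr_unit.ringInverse
  refine Unitary.mem_iff.2 ⟨h, ?_⟩
  rw [polar, ← hr, ← hv] at h ⊢
  rw [v.mul_eq_one_iff_eq_inv.1 h, Units.mul_inv]

theorem polar_intertwines : ∀ᶠ u in 𝓝 (1 : A), ∀ e f, star e = e → star f = f →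
    u * e = f * u → polar u * e = f * polar u := by
  filter_upwards [tendsto_star_mul_self.eventually commute_localSqrt] with u hcomm e f he hf huef
  have heu : e * star u = star u * f := by
    simpa only [star_mul, he, hf] using congrArg star huef
  have hcomm_e : Commute e (star u * u) :=
    calc e * (star u * u) = star u * (f * u) := by rw [← mul_assoc, heu, mul_assoc]
      _ = star u * u * e := by rw [← huef, mul_assoc]
  calc polar u * e = u * (e * (localSqrt (star u * u))⁻¹ʳ) := by
        rw [polar, mul_assoc, (commute_ringInverse_right (hcomm e hcomm_e)).eq]
    _ = f * polar u := by rw [← mul_assoc, huef, mul_assoc, polar]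

theorem map_polar {τ : A ≃⋆ₐ[ℝ] A} (hτ : Continuous τ) :
    ∀ᶠ u in 𝓝 (1 : A), τ u = u → τ (polar u) = polar u := by
  have hτ1 : Tendsto τ (𝓝 1) (𝓝 1) := by simpa using hτ.tendsto 1
  filter_upwards [tendsto_star_mul_self.eventually
    (map_localSqrt hτ1 fun a => map_mul τ a a)] with u hsqrt hu
  rw [polar, map_mul, map_ringInverse, hsqrt (by rw [map_mul, map_star, hu]), hu]

end Polar

section RangeProjections

section Algebraic

variable {A : Type*} [Ring A] [StarRing A]

/-- The operator `star g * g`, compressed to the range of the projection `e` and extended by the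
identity on the kernel of `e`. -/
def compressedGram (e g : A) : A := e * star g * g * e + (1 - e)

/-- The orthogonal projection onto the range of `g * e`, where `e` is an orthogonal projection; it
is junk unless `compressedGram e g` is invertible. -/
noncomputable def rangeProj (e g : A) : A :=
  g * e * (compressedGram e g)⁻¹ʳ * e * star g

theorem compressedGram_one {e : A} (he : IsStarProjection e) : compressedGram e 1 = 1 := by
  rw [compressedGram, star_one, mul_one, mul_one, he.isIdempotentElem.eq, add_sub_cancel]

theorem rangeProj_one {e : A} (he : IsStarProjection e) : rangeProj e 1 = e := by
  rw [rangeProj, compressedGram_one he, Ring.inverse_one, star_one, one_mul, mul_one, mul_one,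
    he.isIdempotentElem.eq]

theorem star_rangeProj {e : A} (he : IsStarProjection e) (g : A) :
    star (rangeProj e g) = rangeProj e g := by
  simp only [rangeProj, compressedGram, star_mul, star_star, ← Ring.inverse_star, star_add,
    star_sub, star_one, he.isSelfAdjoint.star_eq, mul_assoc]

theorem rangeProj_mul {e g : A} (he : IsStarProjection e) (hg : IsUnit (compressedGram e g)) :
    rangeProj e g * (g * e) = g * e := by
  have hmul : e * star g * (g * e) = compressedGram e g * e := by
    rw [compressedGram, add_mul, sub_mul, one_mul, he.isIdempotentElem.eq, sub_self, add_zero,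
      mul_assoc _ e e, he.isIdempotentElem.eq, mul_assoc (e * star g)]
  calc rangeProj e g * (g * e)
      = g * e * ((compressedGram e g)⁻¹ʳ * (e * star g * (g * e))) := by
        simp only [rangeProj, mul_assoc]
    _ = g * e := by
        rw [hmul, Ring.inverse_mul_cancel_left _ _ hg, mul_assoc, he.isIdempotentElem.eq]

theorem isIdempotentElem_rangeProj {e g : A} (he : IsStarProjection e)
    (hg : IsUnit (compressedGram e g)) : IsIdempotentElem (rangeProj e g) := by
  calc rangeProj e g * rangeProj e g
      = rangeProj e g * (g * e) * ((compressedGram e g)⁻¹ʳ * e * star g) := by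
        conv_lhs => rw [rangeProj.eq_def e g]
        simp only [rangeProj, mul_assoc]
    _ = rangeProj e g := by rw [rangeProj_mul he hg]; simp only [rangeProj, mul_assoc]

theorem rangeProj_mul_rangeProj_eq_zero {e f g h : A} (hef : e * f = 0) (hgh : star g * h = 1) :
    rangeProj e g * rangeProj f h = 0 := by
  calc rangeProj e g * rangeProj f h
      = g * e * (compressedGram e g)⁻¹ʳ * (e * (star g * h) * f) *
          (compressedGram f h)⁻¹ʳ * f * star h := by simp only [rangeProj, mul_assoc]
    _ = 0 := by rw [hgh, mul_one, hef, mul_zero, zero_mul, zero_mul, zero_mul]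

theorem map_rangeProj [Algebra ℝ A] (τ : A ≃⋆ₐ[ℝ] A) (e g : A) :
    τ (rangeProj e g) = rangeProj (τ e) (τ g) := by
  simp only [rangeProj, compressedGram, map_mul, map_ringInverse, map_add, map_sub, map_one,
    map_star]

/-- Given orthogonal projections `e` and `e'` with `e * e' = 0`, an element that carries the range
of `e` to that of `g * e`, and the range of `e'` to the image of `e'` under the inverse adjoint of
`g`.  This is Kato's transformation function for a triple of projections with sum `1`. -/
noncomputable def projTransport (e e' g : A) : A :=
  rangeProj e g * e + rangeProj e' (star g⁻¹ʳ) * e' +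
    (1 - rangeProj e g - rangeProj e' (star g⁻¹ʳ)) * (1 - e - e')

variable {e e' : A}

theorem mul_eq_zero_symm (he : IsStarProjection e) (he' : IsStarProjection e')
    (hee' : e * e' = 0) : e' * e = 0 := by
  simpa only [star_mul, star_zero, he.isSelfAdjoint.star_eq, he'.isSelfAdjoint.star_eq] using
    congrArg star hee'

theorem projTransport_one (he : IsStarProjection e) (he' : IsStarProjection e')
    (hee' : e * e' = 0) : projTransport e e' 1 = 1 := by
  rw [projTransport, Ring.inverse_one, star_one, rangeProj_one he, rangeProj_one he']
  simp only [sub_mul, mul_sub, one_mul, mul_one, hee', mul_eq_zero_symm he he' hee',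
    he.isIdempotentElem.eq, he'.isIdempotentElem.eq]
  abel

theorem projTransport_mul (he : IsStarProjection e) (he' : IsStarProjection e')
    (hee' : e * e' = 0) {g : A} (hg : IsUnit g) (hgram : IsUnit (compressedGram e g)) :
    projTransport e e' g * e = rangeProj e g * projTransport e e' g := by
  have hff' : rangeProj e g * rangeProj e' (star g⁻¹ʳ) = 0 :=
    rangeProj_mul_rangeProj_eq_zero hee'
      (by rw [← star_mul, Ring.inverse_mul_cancel _ hg, star_one])
  have hcompl : (1 - e - e') * e = 0 := by
    simp only [sub_mul, one_mul, he.isIdempotentElem.eq, mul_eq_zero_symm he he' hee', sub_self]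
  have hcompl' : rangeProj e g * (1 - rangeProj e g - rangeProj e' (star g⁻¹ʳ)) = 0 := by
    simp only [mul_sub, mul_one, (isIdempotentElem_rangeProj he hgram).eq, hff', sub_self]
  calc projTransport e e' g * e = rangeProj e g * e := by
        simp only [projTransport, add_mul, mul_assoc, he.isIdempotentElem.eq,
          mul_eq_zero_symm he he' hee', hcompl, mul_zero, add_zero]
    _ = rangeProj e g * projTransport e e' g := by
        simp only [projTransport, mul_add, ← mul_assoc, (isIdempotentElem_rangeProj he hgram).eq,
          hff', hcompl', zero_mul, add_zero]

theorem map_projTransport [Algebra ℝ A] {τ : A ≃⋆ₐ[ℝ] A} (hτe : τ e = e') (hτe' : τ e' = e) {g : A}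
    (hg : IsUnit g) (hτg : τ g = star g⁻¹ʳ) : τ (projTransport e e' g) = projTransport e e' g := by
  have hτg' : τ (star g⁻¹ʳ) = g := by
    obtain ⟨u, rfl⟩ := hg
    rw [map_star, map_ringInverse, hτg, ← Ring.inverse_star, star_star, Ring.inverse_unit,
      Ring.inverse_unit, inv_inv]
  simp only [projTransport, map_add, map_mul, map_sub, map_one, map_rangeProj, hτe, hτe', hτg,
    hτg']
  noncomm_ring

end Algebraic

section Smooth

variable {A : Type*} [NormedRing A] [CompleteSpace A] [StarRing A] [ContinuousStar A] {e e' : A}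

theorem eventually_isUnit_compressedGram (he : IsStarProjection e) :
    ∀ᶠ g in 𝓝 (1 : A), IsUnit (compressedGram e g) := by
  have hcont : Continuous (compressedGram e) := by unfold compressedGram; fun_prop
  exact (hcont.tendsto' 1 1 (compressedGram_one he)).eventually eventually_isUnit

variable [NormedAlgebra ℝ A] [StarModule ℝ A]

theorem contDiffAt_rangeProj (he : IsStarProjection e) :
    ContDiffAt ℝ ∞ (rangeProj e) 1 := by
  have hstar : ContDiffAt ℝ ∞ (star : A → A) 1 := contDiffAt_star
  have hgram : ContDiffAt ℝ ∞ (compressedGram e) 1 :=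
    (((contDiffAt_const.mul hstar).mul contDiffAt_id).mul contDiffAt_const).add contDiffAt_const
  have hinv : ContDiffAt ℝ ∞ (Ring.inverse : A → A) (compressedGram e 1) := by
    simpa [compressedGram_one he] using contDiffAt_ringInverse ℝ (1 : Aˣ)
  exact (((contDiffAt_id.mul contDiffAt_const).mul (hinv.comp 1 hgram)).mul contDiffAt_const).mul
    hstar

theorem contDiffAt_projTransport (he : IsStarProjection e) (he' : IsStarProjection e') :
    ContDiffAt ℝ ∞ (projTransport e e') 1 := by
  have hf : ContDiffAt ℝ ∞ (rangeProj e) 1 := contDiffAt_rangeProj he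
  have hadj : ContDiffAt ℝ ∞ (fun g : A => star g⁻¹ʳ) 1 :=
    contDiffAt_star.comp 1 (by simpa using contDiffAt_ringInverse ℝ (1 : Aˣ))
  have hf' : ContDiffAt ℝ ∞ (fun g : A => rangeProj e' (star g⁻¹ʳ)) 1 :=
    ContDiffAt.comp (g := rangeProj e') 1 (by simpa using contDiffAt_rangeProj he') hadj
  exact ((hf.mul contDiffAt_const).add (hf'.mul contDiffAt_const)).add
    (((contDiffAt_const.sub hf).sub hf').mul contDiffAt_const)

end Smooth

end RangeProjections

section Parabolic

variable {M : Type*} [Monoid M]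

/-- The stabilizer in `Mˣ` of the right ideal generated by `e`; for an idempotent matrix `e` this
is the stabilizer of the column space of `e`. -/
def parabolic (e : M) : Subgroup Mˣ where
  carrier := {g | e ∣ g * e ∧ e ∣ ↑g⁻¹ * e}
  one_mem' := by simp
  mul_mem' {g h} hg hh := by
    have hmul {a b : M} (ha : e ∣ a * e) (hb : e ∣ b * e) : e ∣ a * b * e := by
      obtain ⟨c, hc⟩ := hb
      rw [mul_assoc, hc, ← mul_assoc]
      exact ha.mul_right c
    exact ⟨hmul hg.1 hh.1, by simpa using hmul hh.2 hg.2⟩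
  inv_mem' {g} hg := ⟨hg.2, by simpa using hg.1⟩

theorem mul_eq_self_of_dvd {S : Type*} [Semigroup S] {e a : S} (he : IsIdempotentElem e)
    (h : e ∣ a) : e * a = a := by
  obtain ⟨c, rfl⟩ := h
  rw [← mul_assoc, he.eq]

theorem coe_inv_eq_star [StarMul M] {k : Mˣ} (hk : (k : M) ∈ unitary M) :
    ((k⁻¹ : Mˣ) : M) = star (k : M) :=
  Units.inv_eq_of_mul_eq_one_left (Unitary.star_mul_self_of_mem hk)

theorem mem_parabolic_of_commute {e : M} {g : Mˣ} (h : Commute (g : M) e) : g ∈ parabolic e :=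
  ⟨⟨g, h.eq⟩, ⟨_, h.units_inv_left.eq⟩⟩

theorem commute_of_mem_parabolic [StarMul M] {e : M} (he : IsStarProjection e) {k : Mˣ}
    (hk : (k : M) ∈ unitary M) (hkP : k ∈ parabolic e) : Commute (k : M) e := by
  have h : e * (k * e) = k * e := mul_eq_self_of_dvd he.isIdempotentElem hkP.1
  have h' : e * (star (k : M) * e) = star (k : M) * e := by
    rw [← coe_inv_eq_star hk]
    exact mul_eq_self_of_dvd he.isIdempotentElem hkP.2
  have h'' : e * (k * e) = e * k := by
    simpa only [star_mul, star_star, he.isSelfAdjoint.star_eq, mul_assoc] using congrArg star h'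
  exact h.symm.trans h''

theorem mem_parabolic_iff_commute [StarMul M] {e : M} (he : IsStarProjection e) {k : Mˣ}
    (hk : (k : M) ∈ unitary M) : k ∈ parabolic e ↔ Commute (k : M) e :=
  ⟨commute_of_mem_parabolic he hk, mem_parabolic_of_commute⟩

theorem inv_mul_mem_parabolic {A : Type*} [Ring A] [StarRing A] {e : A} (he : IsStarProjection e)
    {g k : Aˣ} (hgram : IsUnit (compressedGram e (g : A))) (hk : (k : A) ∈ unitary A)
    (hke : k * e = rangeProj e g * k) : k⁻¹ * g ∈ parabolic e := by
  have hek : e * ((k⁻¹ : Aˣ) : A) = ((k⁻¹ : Aˣ) : A) * rangeProj e g := by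
    simpa only [coe_inv_eq_star hk, star_mul, he.isSelfAdjoint.star_eq, star_rangeProj he] using
      congrArg star hke
  refine ⟨⟨((k⁻¹ * g : Aˣ) : A) * e, ?_⟩,
    ⟨(compressedGram e (g : A))⁻¹ʳ * e * star (g : A) * k, ?_⟩⟩
  · rw [Units.val_mul, ← mul_assoc, ← mul_assoc, hek, mul_assoc, mul_assoc, mul_assoc,
      rangeProj_mul he hgram]
  · rw [mul_inv_rev, inv_inv, Units.val_mul, mul_assoc, hke]
    simp only [rangeProj, mul_assoc, Units.inv_mul_cancel_left]

end Parabolic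

section FormGroups

variable {A : Type*} [Ring A] [StarRing A] [Algebra ℝ A] {Φ : Finset (A ≃⋆ₐ[ℝ] A)} {e e' : A}
  {g k : Aˣ}

/-- The units that preserve the forms `⟨x, y⟩ ↦ τ(x*) y` for all `τ ∈ Φ`.  In a matrix algebra, an
inner automorphism `τ` gives the isometries of a Hermitian or skew Hermitian form, and an inner
automorphism composed with the complex conjugation of matrices gives those of a bilinear form. -/
def formGroup (Φ : Finset (A ≃⋆ₐ[ℝ] A)) : Subgroup Aˣ where
  carrier := {g | ∀ τ ∈ Φ, τ (star (g : A)) * g = 1}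
  one_mem' τ _ := by simp
  mul_mem' {g h} hg hh τ hτ := by
    calc τ (star ((g * h : Aˣ) : A)) * (g * h : Aˣ)
        = τ (star (h : A)) * (τ (star (g : A)) * g) * h := by
          simp only [Units.val_mul, star_mul, map_mul, mul_assoc]
      _ = 1 := by rw [hg τ hτ, mul_one, hh τ hτ]
  inv_mem' {g} hg τ hτ := by
    have hinv : ((g⁻¹ : Aˣ) : A) = τ (star (g : A)) := Units.inv_eq_of_mul_eq_one_left (hg τ hτ)
    calc τ (star ((g⁻¹ : Aˣ) : A)) * ((g⁻¹ : Aˣ) : A)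
        = τ (star (g * ((g⁻¹ : Aˣ) : A))) := by rw [star_mul, map_mul, ← hinv]
      _ = 1 := by rw [Units.mul_inv, star_one, map_one]

theorem map_star_of_mem_formGroup (hg : g ∈ formGroup Φ) {τ : A ≃⋆ₐ[ℝ] A} (hτ : τ ∈ Φ) :
    τ (star (g : A)) = ((g⁻¹ : Aˣ) : A) :=
  (Units.inv_eq_of_mul_eq_one_left (hg τ hτ)).symm

theorem map_of_mem_formGroup (hg : g ∈ formGroup Φ) {τ : A ≃⋆ₐ[ℝ] A} (hτ : τ ∈ Φ) :
    τ g = star ((g⁻¹ : Aˣ) : A) := by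
  rw [← map_star_of_mem_formGroup hg hτ, map_star, star_star]

theorem mem_formGroup_iff_of_mem_unitary (hk : (k : A) ∈ unitary A) :
    k ∈ formGroup Φ ↔ ∀ τ ∈ Φ, τ k = k := by
  refine ⟨fun h τ hτ => ?_, fun h τ hτ => ?_⟩
  · rw [map_of_mem_formGroup h hτ, coe_inv_eq_star hk, star_star]
  · rw [map_star, h τ hτ, Unitary.star_mul_self_of_mem hk]

/-- Orthogonal projections `e` and `e'` onto opposite subspaces: they are exchanged by the
automorphisms that define `formGroup Φ`, and if there are none they are complementary. -/
structure IsOppositePair (Φ : Finset (A ≃⋆ₐ[ℝ] A)) (e e' : A) : Prop where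
  left : IsStarProjection e
  right : IsStarProjection e'
  mul_eq_zero : e * e' = 0
  map_left : ∀ τ ∈ Φ, τ e = e'
  map_right : ∀ τ ∈ Φ, τ e' = e
  nonempty_or_add_eq_one : Φ.Nonempty ∨ e + e' = 1

theorem IsOppositePair.commute_right (h : IsOppositePair Φ e e') (hk : (k : A) ∈ unitary A)
    (hkG : k ∈ formGroup Φ) (hke : Commute (k : A) e) : Commute (k : A) e' := by
  obtain ⟨τ, hτ⟩ | hee' := h.nonempty_or_add_eq_one
  · rw [← h.map_left τ hτ, ← (mem_formGroup_iff_of_mem_unitary hk).1 hkG τ hτ]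
    exact hke.map τ
  · rw [eq_sub_of_add_eq' hee']
    exact (Commute.one_right _).sub_right hke

end FormGroups

section LocalSection

variable {A : Type*} [NormedRing A] [NormedAlgebra ℝ A] [CompleteSpace A] [StarRing A]
  {Φ : Finset (A ≃⋆ₐ[ℝ] A)} {e e' : A}

/-- A smooth choice, for `g` near `1`, of a unitary element of `formGroup Φ` with the same coset as
`g` modulo `parabolic e`. -/
noncomputable def unitarySection (e e' g : A) : A := polar (projTransport e e' g)

theorem unitarySection_one (h : IsOppositePair Φ e e') : unitarySection e e' 1 = 1 := by
  rw [unitarySection, projTransport_one h.left h.right h.mul_eq_zero, polar_one]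

variable [ContinuousStar A] [StarModule ℝ A]

theorem contDiffAt_unitarySection (h : IsOppositePair Φ e e') :
    ContDiffAt ℝ ∞ (unitarySection e e') 1 := by
  refine ContDiffAt.comp (g := polar) 1 ?_ (contDiffAt_projTransport h.left h.right)
  rw [projTransport_one h.left h.right h.mul_eq_zero]
  exact contDiffAt_polar

theorem exists_coe_eq_unitarySection (h : IsOppositePair Φ e e') (hΦ : ∀ τ ∈ Φ, Continuous τ) :
    ∀ᶠ x in 𝓝 (1 : A), ∀ g ∈ formGroup Φ, (g : A) = x → ∃ k ∈ formGroup Φ,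
      (k : A) ∈ unitary A ∧ (k : A) = unitarySection e e' x ∧ k⁻¹ * g ∈ parabolic e := by
  have htrans : Tendsto (projTransport e e') (𝓝 1) (𝓝 1) := by
    simpa only [projTransport_one h.left h.right h.mul_eq_zero] using
      (contDiffAt_projTransport h.left h.right).continuousAt.tendsto
  filter_upwards [htrans.eventually polar_mem_unitary, htrans.eventually polar_intertwines,
    htrans.eventually ((Filter.eventually_all_finset Φ).2 fun τ hτ => map_polar (hΦ τ hτ)),
    eventually_isUnit_compressedGram h.left] with x hunitary hpolar hmap hgram g hg hgx
  subst hgx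
  let k : Aˣ := Unitary.toUnits ⟨_, hunitary⟩
  have hginv : star (g : A)⁻¹ʳ = star ((g⁻¹ : Aˣ) : A) := by rw [Ring.inverse_unit]
  refine ⟨k, (mem_formGroup_iff_of_mem_unitary hunitary).2 fun τ hτ => hmap τ hτ ?_, hunitary, rfl,
    inv_mul_mem_parabolic h.left hgram hunitary ?_⟩
  · exact map_projTransport (h.map_left τ hτ) (h.map_right τ hτ) g.isUnit
      (by rw [hginv, map_of_mem_formGroup hg hτ])
  · exact hpolar _ _ h.left.isSelfAdjoint (star_rangeProj h.left _)
      (projTransport_mul h.left h.right h.mul_eq_zero g.isUnit hgram)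

end LocalSection

section IdentityComponent

variable {Γ : Type*} [Group Γ] [TopologicalSpace Γ] [IsTopologicalGroup Γ] {S G K P : Subgroup Γ}

/-- The identity component of a subgroup `S`, as a subgroup of the ambient group. -/
def identityComponent (S : Subgroup Γ) : Subgroup Γ :=
  (Subgroup.connectedComponentOfOne S).map S.subtype

theorem identityComponent_le : identityComponent S ≤ S := Subgroup.map_subtype_le _

theorem isPreconnected_identityComponent : IsPreconnected (identityComponent S : Set Γ) := by
  rw [identityComponent, Subgroup.coe_map]
  exact isPreconnected_connectedComponent.image _ continuous_subtype_val.continuousOn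

theorem subset_identityComponent {C : Set Γ} (hC : IsPreconnected C) (h1 : 1 ∈ C)
    (hCS : C ⊆ S) : C ⊆ identityComponent S := by
  intro x hx
  have hind : IsInducing S.subtype := IsInducing.subtypeVal
  have hC' : IsPreconnected (S.subtype ⁻¹' C) := by
    rwa [← hind.isPreconnected_image, Set.image_preimage_eq_of_subset (by simpa using hCS)]
  exact ⟨⟨x, hCS hx⟩, hC'.subset_connectedComponent h1 hx, rfl⟩

theorem isOpen_subgroupOf_iff :
    IsOpen (G.subgroupOf S : Set S) ↔ ∀ᶠ g in 𝓝 (1 : Γ), g ∈ S → g ∈ G := by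
  have hnhds : (G.subgroupOf S : Set S) ∈ 𝓝 (1 : S) ↔ ∀ᶠ g in 𝓝 (1 : Γ), g ∈ S → g ∈ G := by
    rw [nhds_subtype_eq_comap, ← Filter.eventually_mem_set, Filter.eventually_comap]
    exact eventually_congr (.of_forall fun g => ⟨fun h hg => h ⟨g, hg⟩ rfl, fun h x hx =>
      Subgroup.mem_subgroupOf.2 (hx ▸ h (hx ▸ x.2))⟩)
  rw [← hnhds]
  exact ⟨fun h => h.mem_nhds (one_mem _), Subgroup.isOpen_of_mem_nhds _⟩

theorem identityComponent_le_of_isOpen (hopen : IsOpen (G.subgroupOf S : Set S)) :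
    identityComponent S ≤ G := by
  rintro _ ⟨x, hx, rfl⟩
  exact IsClopen.connectedComponent_subset ⟨Subgroup.isClosed_of_isOpen _ hopen, hopen⟩
    (one_mem _) hx

theorem identityComponent_le_identityComponent (hopen : IsOpen (G.subgroupOf S : Set S)) :
    identityComponent S ≤ identityComponent G :=
  subset_identityComponent isPreconnected_identityComponent (one_mem _)
    (identityComponent_le_of_isOpen hopen)

theorem isOpen_identityComponent_subgroupOf
    (hS : IsOpen ((identityComponent S).subgroupOf S : Set S))
    (hopen : IsOpen (G.subgroupOf S : Set S)) :
    IsOpen ((identityComponent G).subgroupOf S : Set S) :=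
  Subgroup.isOpen_mono (Subgroup.comap_mono (identityComponent_le_identityComponent hopen)) hS

theorem map_mem_identityComponent {f : Γ → Γ} (hf : Continuous f) (hf1 : f 1 = 1)
    (hfS : ∀ x ∈ S, f x ∈ S) {x : Γ} (hx : x ∈ identityComponent S) :
    f x ∈ identityComponent S :=
  subset_identityComponent (isPreconnected_identityComponent.image f hf.continuousOn)
    ⟨1, one_mem _, hf1⟩
    (Set.image_subset_iff.2 fun y hy => hfS y (identityComponent_le hy))
    (Set.mem_image_of_mem f hx)

theorem isClosed_of_isOpen_subgroupOf (hS : IsClosed (S : Set Γ)) (hGS : G ≤ S)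
    (hopen : IsOpen (G.subgroupOf S : Set S)) : IsClosed (G : Set Γ) := by
  have himage : (↑) '' (G.subgroupOf S : Set S) = (G : Set Γ) := by
    rw [← Subgroup.coe_subtype, ← Subgroup.coe_map, Subgroup.map_subgroupOf_eq_of_le hGS]
  rw [← himage]
  have hclosed : IsClosed (G.subgroupOf S : Set S) := Subgroup.isClosed_of_isOpen _ hopen
  exact hclosed.trans hS

open scoped Pointwise in
/-- A product of a compact and a closed subgroup which is a neighborhood of the identity is open
and closed. -/
theorem exists_inv_mul_mem_of_mem_identityComponent (hKS : K ≤ S) (hK : IsCompact (K : Set Γ))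
    (hP : IsClosed (P : Set Γ))
    (hKP : ∀ᶠ g in 𝓝 (1 : Γ), g ∈ S → ∃ k ∈ K, k⁻¹ * g ∈ P) {g : Γ}
    (hg : g ∈ identityComponent S) : ∃ k ∈ K, k⁻¹ * g ∈ P := by
  obtain ⟨x, hx, rfl⟩ := hg
  let Q : Set S := {s | ∃ k ∈ K, k⁻¹ * (s : Γ) ∈ P}
  have hclosed : IsClosed Q := by
    have hQ : Q = (↑) ⁻¹' ((K : Set Γ) * (P : Set Γ)) := by
      ext s
      simp only [Q, Set.mem_ofPred_eq, Set.mem_preimage, Set.mem_mul, SetLike.mem_coe]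
      exact exists_congr fun k => and_congr_right fun _ =>
        ⟨fun h => ⟨_, h, mul_inv_cancel_left _ _⟩,
          fun ⟨p, hp, h⟩ => by rwa [← h, inv_mul_cancel_left]⟩
    rw [hQ]
    exact (hP.mul_left_of_isCompact hK).preimage continuous_subtype_val
  have hopen : IsOpen Q := by
    refine isOpen_iff_mem_nhds.2 fun q ⟨k, hk, hq⟩ => ?_
    have htrans : Tendsto (fun s : S => k⁻¹ * (s : Γ) * (k⁻¹ * q)⁻¹) (𝓝 q) (𝓝 1) :=
      Continuous.tendsto' (by fun_prop) _ _ (mul_inv_cancel _)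
    filter_upwards [htrans.eventually hKP] with s hs
    have hkS := inv_mem (hKS hk)
    obtain ⟨k', hk', hs'⟩ := hs (mul_mem (mul_mem hkS s.2) (inv_mem (mul_mem hkS q.2)))
    refine ⟨k * k', mul_mem hk hk', ?_⟩
    simpa [mul_assoc] using mul_mem hs' hq
  exact IsClopen.connectedComponent_subset ⟨hclosed, hopen⟩ ⟨1, one_mem _, by simp⟩ hx

end IdentityComponent

section CayleyPath

variable {A : Type*} [Ring A] [Algebra ℝ A]

/-- The Cayley path `(s g + (1 - s)) / ((1 - s) g + s)`, which runs from `1` at `s = 1 / 2` to `g`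
at `s = 1`; unlike a straight line it stays in the groups `formGroup Φ`. -/
noncomputable def cayleyPath (g : A) (s : ℝ) : A :=
  (s • g + (1 - s) • 1) * ((1 - s) • g + s • 1)⁻¹ʳ

theorem cayleyPath_one (g : A) : cayleyPath g 1 = g := by simp [cayleyPath]

theorem commute_smul_add_smul_one {g x : A} (h : Commute x g) (s t : ℝ) :
    Commute x (s • g + t • 1) :=
  (h.smul_right s).add_right ((Commute.one_right x).smul_right t)

theorem commute_cayleyPath {g x : A} (h : Commute x g) (s : ℝ) : Commute x (cayleyPath g s) :=
  (commute_smul_add_smul_one h _ _).mul_right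
    (commute_ringInverse_right (commute_smul_add_smul_one h _ _))

theorem star_cayleyPath [StarRing A] [StarModule ℝ A] {g : A} (hg : star g = g) (s : ℝ) :
    star (cayleyPath g s) = cayleyPath g s := by
  have hline (s t : ℝ) : star (s • g + t • (1 : A)) = s • g + t • 1 := by simp [hg]
  have hcomm : Commute ((1 - s) • g + s • 1) (s • g + (1 - s) • 1) :=
    commute_smul_add_smul_one (commute_smul_add_smul_one (Commute.refl g) _ _).symm _ _
  rw [cayleyPath, star_mul, ← Ring.inverse_star, hline, hline,
    (commute_ringInverse_right hcomm.symm).eq]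

theorem cayleyPath_half {g : A} (h : ∀ s ∈ Set.Icc (0 : ℝ) 1, IsUnit (s • g + (1 - s) • 1)) :
    cayleyPath g (1 / 2) = 1 := by
  have h2 := h (1 / 2) (by norm_num)
  rw [cayleyPath]
  norm_num at h2 ⊢
  exact Ring.mul_inverse_cancel _ h2

theorem isUnit_cayleyPath {g : A} (h : ∀ s ∈ Set.Icc (0 : ℝ) 1, IsUnit (s • g + (1 - s) • 1))
    {s : ℝ} (hs : s ∈ Set.Icc 0 1) : IsUnit (cayleyPath g s) := by
  have h' := h (1 - s) ⟨by linarith [hs.2], by linarith [hs.1]⟩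
  rw [sub_sub_cancel] at h'
  exact (h s hs).mul h'.ringInverse

theorem mem_formGroup_of_coe_eq_cayleyPath [StarRing A] [StarModule ℝ A] {Φ : Finset (A ≃⋆ₐ[ℝ] A)}
    {g u : Aˣ} (hg : g ∈ formGroup Φ) {s : ℝ}
    (h : ∀ s ∈ Set.Icc (0 : ℝ) 1, IsUnit (s • (g : A) + (1 - s) • 1)) (hs : s ∈ Set.Icc 0 1)
    (hu : (u : A) = cayleyPath (g : A) s) : u ∈ formGroup Φ := by
  intro τ hτ
  obtain ⟨d, hd⟩ := h s hs
  obtain ⟨d', hd'⟩ := h (1 - s) ⟨by linarith [hs.2], by linarith [hs.1]⟩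
  rw [sub_sub_cancel] at hd'
  have hcomm : (d : A) * d' = d' * d := by
    rw [hd, hd']
    exact commute_smul_add_smul_one (commute_smul_add_smul_one (Commute.refl (g : A)) _ _).symm _ _
  have hadj (s t : ℝ) : g * τ (star (s • (g : A) + t • 1)) = t • (g : A) + s • 1 := by
    simp [map_star_of_mem_formGroup hg hτ, mul_add, add_comm]
  have hud' : (u : A) * d' = d := by
    rw [hu, cayleyPath, ← hd, ← hd', Ring.inverse_unit, Units.inv_mul_cancel_right]
  have hdu : d * τ (star (u : A)) = d' :=
    calc d * τ (star (u : A)) = g * τ (star ((u : A) * d')) := by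
          rw [star_mul, map_mul, ← mul_assoc, hd', hadj, hd]
      _ = d' := by rw [hud', hd, hadj, hd']
  refine (Units.mul_right_inj d).1 ((Units.mul_left_inj d').1 ?_)
  rw [← mul_assoc, hdu, mul_one, mul_assoc, hud', hcomm]

theorem isUnit_smul_star_mul_self_add [StarRing A] [StarModule ℝ A]
    (hA : ∀ x : A, IsUnit (1 + star x * x)) (g : Aˣ) {s : ℝ} (hs : s ∈ Set.Icc 0 1) :
    IsUnit (s • ((star g * g : Aˣ) : A) + (1 - s) • 1) := by
  obtain rfl | hs1 := hs.2.eq_or_lt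
  · simpa only [one_smul, sub_self, zero_smul, add_zero] using (star g * g).isUnit
  have hs1' : 0 < 1 - s := sub_pos.2 hs1
  let c : ℝ := √(s / (1 - s))
  have hc : (1 - s) * (c * c) = s := by
    rw [Real.mul_self_sqrt (div_nonneg hs.1 hs1'.le), mul_div_cancel₀ _ hs1'.ne']
  have heq : s • ((star g * g : Aˣ) : A) + (1 - s) • 1 =
      (1 - s) • (1 + star (c • (g : A)) * (c • (g : A))) := by
    rw [star_smul, star_trivial c, smul_mul_smul_comm, smul_add, smul_smul, hc, Units.val_mul,
      Units.coe_star, add_comm]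
  rw [heq]
  exact (hA _).smul (Units.mk0 (1 - s) hs1'.ne')

end CayleyPath

section SelfAdjointTorus

variable {A : Type*} [Ring A] [StarRing A] [Algebra ℝ A] {Φ : Finset (A ≃⋆ₐ[ℝ] A)}

/-- The self-adjoint elements of `formGroup Φ` in the double centralizer of `a`; they form a
commutative group. -/
def selfAdjointTorus (Φ : Finset (A ≃⋆ₐ[ℝ] A)) (a : Aˣ) : Subgroup Aˣ where
  carrier := {x | x ∈ formGroup Φ ∧ star x = x ∧ ∀ y, Commute y a → Commute y x}
  one_mem' := ⟨one_mem _, star_one _, fun y _ => Commute.one_right y⟩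
  mul_mem' {x y} hx hy := by
    have hxy : Commute x y := hy.2.2 x (hx.2.2 a (Commute.refl a)).symm
    refine ⟨mul_mem hx.1 hy.1, ?_, fun z hz => (hx.2.2 z hz).mul_right (hy.2.2 z hz)⟩
    rw [star_mul, hx.2.1, hy.2.1, hxy.eq]
  inv_mem' {x} hx := ⟨inv_mem hx.1, by rw [star_inv, hx.2.1], fun z hz => (hx.2.2 z hz).inv_right⟩

theorem commute_of_mem_selfAdjointTorus {a x y : Aˣ} (hx : x ∈ selfAdjointTorus Φ a)
    (hy : y ∈ selfAdjointTorus Φ a) : Commute x y :=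
  hy.2.2 x (hx.2.2 a (Commute.refl a)).symm

theorem mem_formGroup_iff_of_star_eq {r : Aˣ} (hr : star (r : A) = r) :
    r ∈ formGroup Φ ↔ ∀ τ ∈ Φ, (τ (r : A))⁻¹ʳ = r := by
  refine forall₂_congr fun τ _ => ?_
  obtain ⟨u, hu⟩ := r.isUnit.map τ
  rw [hr, ← hu, Ring.inverse_unit, ← Units.val_mul, Units.val_eq_one, Units.val_inj,
    mul_eq_one_iff_inv_eq]

end SelfAdjointTorus

section PositiveRoot

theorem tendsto_units_val {M : Type*} [Monoid M] [TopologicalSpace M] :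
    Tendsto ((↑) : Mˣ → M) (𝓝 1) (𝓝 1) :=
  Units.continuous_val.tendsto' 1 1 Units.val_one

theorem eventually_units_iff {A : Type*} [NormedRing A] [CompleteSpace A]
    {p : Aˣ → Prop} :
    (∀ᶠ g in 𝓝 (1 : Aˣ), p g) ↔ ∀ᶠ x in 𝓝 (1 : A), ∀ g : Aˣ, (g : A) = x → p g := by
  rw [Units.isOpenEmbedding_val.isInducing.nhds_eq_comap, Filter.eventually_comap, Units.val_one]

variable {A : Type*} [NormedRing A] [NormedAlgebra ℝ A] [CompleteSpace A]

theorem mem_identityComponent_of_cayleyPath {T : Subgroup Aˣ} {g : Aˣ}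
    (h : ∀ s ∈ Set.Icc (0 : ℝ) 1, IsUnit (s • (g : A) + (1 - s) • 1))
    (hT : ∀ s ∈ Set.Icc (0 : ℝ) 1, ∀ u : Aˣ, (u : A) = cayleyPath (g : A) s → u ∈ T) :
    g ∈ identityComponent T := by
  let I : Set ℝ := Set.Icc 0 1
  let C : Set Aˣ := {u | (u : A) ∈ cayleyPath (g : A) '' I}
  have hcont : ContinuousOn (cayleyPath (g : A)) I := by
    intro s hs
    obtain ⟨d, hd⟩ := h (1 - s) ⟨by linarith [hs.2], by linarith [hs.1]⟩
    rw [sub_sub_cancel] at hd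
    have hline : Continuous fun s : ℝ => (1 - s) • (g : A) + s • 1 := by fun_prop
    have hinv : ContinuousAt (fun s : ℝ => ((1 - s) • (g : A) + s • 1)⁻¹ʳ) s :=
      ContinuousAt.comp (g := Ring.inverse) (hd ▸ NormedRing.inverse_continuousAt d)
        hline.continuousAt
    exact (ContinuousAt.mul (by fun_prop) hinv).continuousWithinAt
  have hval : ((↑) : Aˣ → A) '' C = cayleyPath (g : A) '' I := by
    refine Set.image_preimage_eq_of_subset ?_
    rintro _ ⟨s, hs, rfl⟩
    exact isUnit_cayleyPath h hs
  have hC : IsPreconnected C := by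
    rw [← Units.isOpenEmbedding_val.isInducing.isPreconnected_image, hval]
    exact isPreconnected_Icc.image _ hcont
  refine subset_identityComponent hC ⟨1 / 2, by norm_num [I], ?_⟩ ?_ ⟨1, by norm_num [I], ?_⟩
  · rw [cayleyPath_half h, Units.val_one]
  · rintro u ⟨s, hs, hu⟩
    exact hT s hs u hu.symm
  · rw [cayleyPath_one]

variable [StarRing A] {Φ : Finset (A ≃⋆ₐ[ℝ] A)}

theorem isOpen_identityComponent_formGroup [StarModule ℝ A] :
    IsOpen ((identityComponent (formGroup Φ)).subgroupOf (formGroup Φ) : Set (formGroup Φ)) := by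
  rw [isOpen_subgroupOf_iff]
  filter_upwards [tendsto_units_val.eventually eventually_norm_sub_one_lt] with g hg hgΦ
  have hunit (s : ℝ) (hs : s ∈ Set.Icc 0 1) : IsUnit (s • (g : A) + (1 - s) • 1) := by
    have heq : s • (g : A) + (1 - s) • 1 = 1 - s • (1 - (g : A)) := by module
    rw [heq]
    refine isUnit_one_sub_of_norm_lt_one ?_
    rw [norm_smul, norm_sub_rev, Real.norm_of_nonneg hs.1]
    nlinarith [hs.2, norm_nonneg ((g : A) - 1)]
  exact mem_identityComponent_of_cayleyPath hunit fun s hs u hu =>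
    mem_formGroup_of_coe_eq_cayleyPath hgΦ hunit hs hu

theorem eventually_exists_sqrt_mem [StarModule ℝ A] [ContinuousStar A]
    (hΦ : ∀ τ ∈ Φ, Continuous τ) (a : Aˣ) :
    ∀ᶠ c in 𝓝 (1 : Aˣ), c ∈ selfAdjointTorus Φ a →
      ∃ r ∈ selfAdjointTorus Φ a ⊓ identityComponent (formGroup Φ), r * r = c := by
  have hopen := eventually_units_iff.1
    (isOpen_subgroupOf_iff.1 (isOpen_identityComponent_formGroup (Φ := Φ)))
  have hτ (τ : A ≃⋆ₐ[ℝ] A) (h : τ ∈ Φ) :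
      ∀ᶠ x in 𝓝 (1 : A), (τ x)⁻¹ʳ = x → (τ (localSqrt x))⁻¹ʳ = localSqrt x :=
    map_localSqrt (τ := fun x => (τ x)⁻¹ʳ)
      (tendsto_ringInverse.comp ((hΦ τ h).tendsto' 1 1 (map_one τ)))
      fun x => by rw [map_mul, ← pow_two, ← Ring.inverse_pow, pow_two]
  rw [eventually_units_iff]
  filter_upwards [localSqrt_mul_self, star_localSqrt, commute_localSqrt,
    tendsto_localSqrt.eventually eventually_isUnit, tendsto_localSqrt.eventually hopen,
    (Filter.eventually_all_finset Φ).2 hτ] with x hsq hstar hcomm hunit hmem hmap c hcx hc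
  subst hcx
  obtain ⟨r, hr⟩ := hunit
  have hcstar : star (c : A) = c := by rw [← Units.coe_star, hc.2.1]
  have hrstar : star (r : A) = r := by rw [hr, hstar hcstar]
  have hrΦ : r ∈ formGroup Φ := (mem_formGroup_iff_of_star_eq hrstar).2 fun τ hτ => by
    rw [hr]
    exact hmap τ hτ ((mem_formGroup_iff_of_star_eq hcstar).1 hc.1 τ hτ)
  refine ⟨r, ⟨⟨hrΦ, Units.ext hrstar, fun y hy => ?_⟩, hmem r hr hrΦ⟩, Units.ext ?_⟩
  · refine Units.ext ?_
    simpa only [Units.val_mul, hr] using (hcomm y (congrArg Units.val (hc.2.2 y hy))).eq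
  · rw [Units.val_mul, hr, hsq]

theorem exists_sqrt_of_mem_identityComponent [StarModule ℝ A] [ContinuousStar A]
    (hΦ : ∀ τ ∈ Φ, Continuous τ) {a : Aˣ} (ha : a ∈ identityComponent (selfAdjointTorus Φ a)) :
    ∃ r ∈ selfAdjointTorus Φ a ⊓ identityComponent (formGroup Φ), r * r = a := by
  let squares : Subgroup Aˣ :=
    { carrier := {x | ∃ r ∈ selfAdjointTorus Φ a ⊓ identityComponent (formGroup Φ), r * r = x}
      one_mem' := ⟨1, one_mem _, mul_one 1⟩
      mul_mem' := by
        rintro _ _ ⟨r, hr, rfl⟩ ⟨r', hr', rfl⟩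
        exact ⟨r * r', mul_mem hr hr',
          (commute_of_mem_selfAdjointTorus hr'.1 hr.1).mul_mul_mul_comm r r'⟩
      inv_mem' := by
        rintro _ ⟨r, hr, rfl⟩
        exact ⟨r⁻¹, inv_mem hr, (mul_inv_rev r r).symm⟩ }
  exact identityComponent_le_of_isOpen (G := squares)
    (isOpen_subgroupOf_iff.2 (eventually_exists_sqrt_mem hΦ a)) ha

theorem exists_mul_inv_mem_unitary [StarModule ℝ A] [ContinuousStar A]
    (hA : ∀ x : A, IsUnit (1 + star x * x)) (hΦ : ∀ τ ∈ Φ, Continuous τ) {g : Aˣ}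
    (hg : g ∈ formGroup Φ) :
    ∃ h ∈ identityComponent (formGroup Φ), ((g * h⁻¹ : Aˣ) : A) ∈ unitary A := by
  let a : Aˣ := star g * g
  have hsegment (s : ℝ) (hs : s ∈ Set.Icc 0 1) : IsUnit (s • (a : A) + (1 - s) • 1) :=
    isUnit_smul_star_mul_self_add hA g hs
  have hgstar : star g ∈ formGroup Φ := fun τ hτ => by
    rw [Units.coe_star, star_star, map_of_mem_formGroup hg hτ, ← star_mul, Units.mul_inv, star_one]
  have ha : star (a : A) = a := by simp [a]
  have haT : a ∈ identityComponent (selfAdjointTorus Φ a) :=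
    mem_identityComponent_of_cayleyPath hsegment fun s hs u hu =>
      ⟨mem_formGroup_of_coe_eq_cayleyPath (mul_mem hgstar hg) hsegment hs hu,
        Units.ext (by rw [Units.coe_star, hu, star_cayleyPath ha]),
        fun y hy => Units.ext (by
          rw [Units.val_mul, Units.val_mul, hu,
            (commute_cayleyPath (congrArg Units.val hy) s).eq])⟩
  obtain ⟨r, ⟨hrT, hr⟩, hra⟩ := exists_sqrt_of_mem_identityComponent hΦ haT
  refine ⟨r, hr, ?_⟩
  have h : star (g * r⁻¹) * (g * r⁻¹) = 1 :=
    calc star (g * r⁻¹) * (g * r⁻¹) = r⁻¹ * (star g * g) * r⁻¹ := by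
          rw [star_mul, star_inv, hrT.2.1]; simp only [mul_assoc]
      _ = 1 := by rw [← show r * r = star g * g from hra]; simp
  rw [Unitary.mem_iff, ← Units.coe_star, ← Units.val_mul, ← Units.val_mul, h,
    mul_eq_one_comm.1 h]
  exact ⟨rfl, rfl⟩

end PositiveRoot

section Transitivity

variable {A : Type*} [NormedRing A] [NormedAlgebra ℝ A] [CompleteSpace A] [StarRing A]
  [StarModule ℝ A] [ContinuousStar A] {Φ : Finset (A ≃⋆ₐ[ℝ] A)} {e e' : A} {G : Subgroup Aˣ}

theorem exists_mem_coe_eq_unitarySection (h : IsOppositePair Φ e e')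
    (hΦ : ∀ τ ∈ Φ, Continuous τ) (hG : G ≤ formGroup Φ)
    (hopen : IsOpen (G.subgroupOf (formGroup Φ) : Set (formGroup Φ))) :
    ∀ᶠ x in 𝓝 (1 : A), ∀ g ∈ G, (g : A) = x → ∃ k ∈ G,
      (k : A) ∈ unitary A ∧ (k : A) = unitarySection e e' x ∧ k⁻¹ * g ∈ parabolic e := by
  have hsection : Tendsto (unitarySection e e') (𝓝 1) (𝓝 1) := by
    simpa only [unitarySection_one h] using (contDiffAt_unitarySection h).continuousAt.tendsto
  filter_upwards [exists_coe_eq_unitarySection h hΦ,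
    hsection.eventually (eventually_units_iff.1 (isOpen_subgroupOf_iff.1 hopen))]
    with x hx hmem g hg hgx
  obtain ⟨k, hk, hku, hkx, hkg⟩ := hx g (hG hg) hgx
  exact ⟨k, hmem k hkx hk, hku, hkx, hkg⟩

/-- The unitary elements, as a subgroup of the group of units. -/
def unitaryUnits (A : Type*) [Monoid A] [StarMul A] : Subgroup Aˣ where
  __ := (unitary A).comap (Units.coeHom A)
  inv_mem' {k} hk := by
    change ((k⁻¹ : Aˣ) : A) ∈ unitary A
    rw [coe_inv_eq_star hk]
    exact Unitary.star_mem hk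

theorem mem_unitaryUnits_of_mul_self {A : Type*} [Monoid A] [StarMul A] {s : Aˣ} (hs : s * s = 1)
    (hs_star : star s = s) : s ∈ unitaryUnits A := by
  have hstar_mul : star s * s = 1 := by rw [hs_star, hs]
  have hmul_star : s * star s = 1 := by rw [hs_star, hs]
  exact Unitary.mem_iff.2 ⟨congrArg Units.val hstar_mul, congrArg Units.val hmul_star⟩

theorem isClosed_parabolic {M : Type*} [Monoid M] [TopologicalSpace M] [ContinuousMul M]
    [T2Space M] {e : M} (he : IsIdempotentElem e) : IsClosed (parabolic e : Set Mˣ) := by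
  have hdvd (a : M) : e ∣ a ↔ e * a = a := ⟨mul_eq_self_of_dvd he, fun h => ⟨a, h.symm⟩⟩
  have hset : (parabolic e : Set Mˣ) =
      {g : Mˣ | e * (g * e) = g * e} ∩ {g : Mˣ | e * (↑g⁻¹ * e) = ↑g⁻¹ * e} :=
    Set.ext fun g => and_congr (hdvd _) (hdvd _)
  rw [hset]
  have hval : Continuous fun g : Mˣ => (g : M) * e := Units.continuous_val.mul continuous_const
  have hinv : Continuous fun g : Mˣ => ((g⁻¹ : Mˣ) : M) * e :=
    Units.continuous_coe_inv.mul continuous_const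
  exact (isClosed_eq (continuous_const.mul hval) hval).inter
    (isClosed_eq (continuous_const.mul hinv) hinv)

/-- Splitting off a positive square root of `star g * g` reduces transitivity to the identity
component, which is exhausted by the compact group because its orbits are open. -/
theorem exists_mem_unitary_inv_mul_mem_parabolic (hA : ∀ x : A, IsUnit (1 + star x * x))
    (h : IsOppositePair Φ e e') (hΦ : ∀ τ ∈ Φ, Continuous τ) (hG : G ≤ formGroup Φ)
    (hopen : IsOpen (G.subgroupOf (formGroup Φ) : Set (formGroup Φ)))
    (hK : IsCompact (G ⊓ unitaryUnits A : Set Aˣ)) {g : Aˣ} (hg : g ∈ G) :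
    ∃ k ∈ G, (k : A) ∈ unitary A ∧ k⁻¹ * g ∈ parabolic e := by
  obtain ⟨r, hr, hu⟩ := exists_mul_inv_mem_unitary hA hΦ (hG hg)
  have hrG : r ∈ identityComponent G := identityComponent_le_identityComponent hopen hr
  have hnear : ∀ᶠ x in 𝓝 (1 : Aˣ), x ∈ G →
      ∃ k ∈ G ⊓ unitaryUnits A, k⁻¹ * x ∈ parabolic e := by
    refine (tendsto_units_val.eventually (exists_mem_coe_eq_unitarySection h hΦ hG hopen)).mono
      fun x hx hxG => ?_
    obtain ⟨k, hk, hku, -, hkx⟩ := hx x hxG rfl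
    exact ⟨k, ⟨hk, hku⟩, hkx⟩
  obtain ⟨k, ⟨hk, hku⟩, hkr⟩ :=
    exists_inv_mul_mem_of_mem_identityComponent inf_le_left hK
      (isClosed_parabolic h.left.isIdempotentElem) hnear hrG
  refine ⟨g * r⁻¹ * k, mul_mem (mul_mem hg (inv_mem (identityComponent_le hrG))) hk,
    mul_mem hu hku, ?_⟩
  rwa [mul_inv_rev, mul_inv_rev, inv_inv, mul_assoc, inv_mul_cancel_right]

end Transitivity

section SymmetricSubgroup

variable {K Γ : Type*} [Group K] [TopologicalSpace K] [IsTopologicalGroup K] [Group Γ]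
  [TopologicalSpace Γ] [IsTopologicalGroup Γ]

/-- The fixed points of conjugation by `s` split into the relatively closed sets `H` and `Z`, so
that `H` contains their identity component. -/
theorem isSymmetricSubgroup_of_conj {f : K →* Γ} (hf : IsEmbedding f) {s : Γ} (hs : s * s = 1)
    (hsf : ∀ k, s * f k * s ∈ f.range) {H : Subgroup K} {Z : Set K} (hZ : IsClosed Z)
    (hH : ∀ k ∈ H, Commute (f k) s) (hHZ : Disjoint (H : Set K) Z)
    (hcover : ∀ k, Commute (f k) s → k ∈ H ∨ k ∈ Z) : IsSymmetricSubgroup H := by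
  choose σ hσ using hsf
  have hσσ (k : K) : σ (σ k) = k := hf.injective (by
    rw [hσ, hσ, ← mul_assoc, ← mul_assoc, hs, one_mul, mul_assoc, hs, mul_one])
  have hσmul (k l : K) : σ (k * l) = σ k * σ l := hf.injective (by
    rw [map_mul, hσ, hσ, hσ, map_mul, mul_assoc (s * f k) s, ← mul_assoc s (s * f l),
      ← mul_assoc s s, hs, one_mul, ← mul_assoc, ← mul_assoc])
  have hfix (k : K) : σ k = k ↔ Commute (f k) s := by
    rw [← hf.injective.eq_iff, hσ, ← eq_mul_inv_iff_mul_eq, inv_eq_of_mul_eq_one_left hs]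
    exact eq_comm
  let σ' : K ≃* K :=
    { toFun := σ, invFun := σ, left_inv := hσσ, right_inv := hσσ, map_mul' := hσmul }
  refine ⟨σ', hf.isInducing.continuous_iff.2 ?_, hσσ, fun k hk => (hfix k).2 (hH k hk),
    identityComponent_le_of_isOpen ?_⟩
  · have hcomp : f ∘ σ' = fun k => s * f k * s := funext hσ
    have hfcont := hf.continuous
    rw [hcomp]
    fun_prop
  · let S := MonoidHom.eqLocus σ'.toMonoidHom (MonoidHom.id K)
    have hcompl : (H.subgroupOf S : Set S)ᶜ = Subtype.val ⁻¹' Z := by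
      ext ⟨k, hk⟩
      exact ⟨fun hkH => (hcover k ((hfix k).1 hk)).resolve_left hkH,
        fun hkZ hkH => Set.disjoint_left.1 hHZ hkH hkZ⟩
    rw [← isClosed_compl_iff, hcompl]
    exact hZ.preimage continuous_subtype_val

end SymmetricSubgroup

section UnitaryUnits

variable {A : Type*} [Monoid A] [StarMul A] [TopologicalSpace A] [ContinuousStar A]

theorem isInducing_val_of_mem_unitaryUnits {S : Type*} [TopologicalSpace S] {f : S → Aˣ}
    (hf : IsInducing f) (hu : ∀ x, f x ∈ unitaryUnits A) : IsInducing fun x => (f x : A) := by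
  have hc : Continuous fun a : A => (a, MulOpposite.op (star a)) := by fun_prop
  refine IsInducing.of_comp (Units.continuous_val.comp hf.continuous) hc ?_
  have hcomp : ((fun a : A => (a, MulOpposite.op (star a))) ∘ fun x => (f x : A)) =
      Units.embedProduct A ∘ f :=
    funext fun x => Prod.ext rfl (congrArg MulOpposite.op (coe_inv_eq_star (hu x)).symm)
  rw [hcomp]
  exact Units.isInducing_embedProduct.comp hf

theorem isCompact_unitaryUnits (h : IsCompact (unitary A : Set A)) :
    IsCompact (unitaryUnits A : Set Aˣ) := by
  have : CompactSpace (unitary A) := isCompact_iff_compactSpace.1 h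
  have hcont : Continuous (Unitary.toUnits : unitary A →* Aˣ) :=
    Units.continuous_iff.2 ⟨continuous_subtype_val, continuous_star.comp continuous_subtype_val⟩
  have hrange : (unitaryUnits A : Set Aˣ) = Set.range (Unitary.toUnits : unitary A →* Aˣ) := by
    ext k
    exact ⟨fun hk => ⟨⟨k, hk⟩, Units.ext rfl⟩, by rintro ⟨u, rfl⟩; exact u.2⟩
  rw [hrange]
  exact isCompact_range hcont

theorem isClosed_formGroup {A : Type*} [Ring A] [StarRing A] [Algebra ℝ A] [TopologicalSpace A]
    [ContinuousMul A] [ContinuousStar A] [T1Space A] {Φ : Finset (A ≃⋆ₐ[ℝ] A)}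
    (hΦ : ∀ τ ∈ Φ, Continuous τ) : IsClosed (formGroup Φ : Set Aˣ) := by
  have hset : (formGroup Φ : Set Aˣ) = ⋂ τ ∈ Φ, {g : Aˣ | τ (star (g : A)) * g = 1} := by
    ext g
    simp only [Set.mem_iInter]
    rfl
  rw [hset]
  refine isClosed_biInter fun τ hτ => isClosed_singleton.preimage ?_
  exact ((hΦ τ hτ).comp (continuous_star.comp Units.continuous_val)).mul Units.continuous_val

end UnitaryUnits

section ConjugationAlgebra

/-- A real normed division algebra with a conjugation such that `x̄ x = ‖x‖²`. -/
class ConjugationAlgebra (F : Type*) [NormedDivisionRing F] [NormedAlgebra ℝ F] [StarRing F] :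
    Prop where
  star_mul_self (x : F) : star x * x = algebraMap ℝ F (‖x‖ ^ 2)

instance {F : Type*} [RCLike F] : ConjugationAlgebra F where
  star_mul_self x := (RCLike.conj_mul x).trans (RCLike.ofReal_pow _ 2).symm

instance : ConjugationAlgebra ℍ[ℝ] where
  star_mul_self x := by
    rw [Quaternion.star_mul_self, Quaternion.normSq_eq_norm_mul_self, sq]
    rfl

instance : StarModule ℝ ℍ[ℝ] where
  star_smul r x := by
    rw [star_trivial r, Algebra.smul_def, star_mul, Algebra.smul_def, Algebra.commutes]
    exact congrArg _ (Quaternion.star_coe r)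

variable {ι F : Type*} [Fintype ι] [NormedDivisionRing F] [NormedAlgebra ℝ F] [StarRing F]
  [ConjugationAlgebra F]

theorem star_mul_self_apply_self (M : Matrix ι ι F) (j : ι) :
    (star M * M) j j = algebraMap ℝ F (∑ i, ‖M i j‖ ^ 2) := by
  simp only [Matrix.mul_apply, Matrix.star_apply, ConjugationAlgebra.star_mul_self, map_sum]

variable [DecidableEq ι]

theorem isUnit_one_add_star_mul_self [FiniteDimensional ℝ F] (M : Matrix ι ι F) :
    IsUnit (1 + star M * M) := by
  have : IsArtinianRing (Matrix ι ι F)ᵐᵒᵖ := IsArtinianRing.of_finite ℝ _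
  rw [IsArtinianRing.isUnit_iff_isLeftRegular, isLeftRegular_iff_right_eq_zero_of_mul]
  intro N hN
  have hsum : star N * N + star (M * N) * (M * N) = 0 := by
    rw [star_mul, mul_assoc, ← mul_assoc (star M), ← mul_add, ← one_add_mul, hN, mul_zero]
  ext i j
  have hj : ∑ i, ‖N i j‖ ^ 2 + ∑ i, ‖(M * N) i j‖ ^ 2 = 0 := by
    refine (algebraMap ℝ F).injective ?_
    rw [map_add, ← star_mul_self_apply_self, ← star_mul_self_apply_self, ← Matrix.add_apply, hsum,
      map_zero, Matrix.zero_apply]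
  have hN0 : ∑ i, ‖N i j‖ ^ 2 = 0 :=
    ((add_eq_zero_iff_of_nonneg (by positivity) (by positivity)).1 hj).1
  have hij := (Finset.sum_eq_zero_iff_of_nonneg fun i _ => sq_nonneg ‖N i j‖).1 hN0 i
    (Finset.mem_univ i)
  simpa using hij

theorem norm_apply_le_one_of_mem_unitary {M : Matrix ι ι F} (hM : M ∈ unitary (Matrix ι ι F))
    (i j : ι) : ‖M i j‖ ≤ 1 := by
  have hj : ∑ i, ‖M i j‖ ^ 2 = 1 := by
    refine (algebraMap ℝ F).injective ?_
    rw [← star_mul_self_apply_self, Unitary.star_mul_self_of_mem hM, Matrix.one_apply_eq, map_one]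
  rw [← sq_le_one_iff₀ (norm_nonneg _), ← hj]
  exact Finset.single_le_sum (f := fun i => ‖M i j‖ ^ 2) (fun i _ => sq_nonneg _)
    (Finset.mem_univ i)

attribute [local instance] Matrix.normedAddCommGroup Matrix.normedSpace in
theorem isCompact_unitary [FiniteDimensional ℝ F] [ContinuousStar F] :
    IsCompact (unitary (Matrix ι ι F) : Set (Matrix ι ι F)) := by
  have : ProperSpace (Matrix ι ι F) := FiniteDimensional.proper_real _
  refine Metric.isCompact_of_isClosed_isBounded ?_ ?_
  · exact (isClosed_eq (by fun_prop) continuous_const).inter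
      (isClosed_eq (by fun_prop) continuous_const)
  · refine (Metric.isBounded_closedBall (x := (0 : Matrix ι ι F)) (r := 1)).subset fun M hM => ?_
    rw [mem_closedBall_zero_iff, Matrix.norm_le_iff zero_le_one]
    exact norm_apply_le_one_of_mem_unitary hM

end ConjugationAlgebra

section Transfer

attribute [local instance] Matrix.normedAddCommGroup Matrix.normedSpace

theorem continuous_starAlgEquiv {ι F : Type*} [Fintype ι] [NormedRing F]
    [NormedAlgebra ℝ F] [FiniteDimensional ℝ F] [StarRing F]
    (τ : Matrix ι ι F ≃⋆ₐ[ℝ] Matrix ι ι F) : Continuous τ :=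
  LinearMap.continuous_of_finiteDimensional (τ : Matrix ι ι F →ₗ[ℝ] Matrix ι ι F)

theorem contDiff_matrix_mul {ι F E : Type*} [Fintype ι] [NormedRing F] [NormedAlgebra ℝ F]
    [NormedAddCommGroup E] [NormedSpace ℝ E] {f g : E → Matrix ι ι F} (hf : ContDiff ℝ ∞ f)
    (hg : ContDiff ℝ ∞ g) : ContDiff ℝ ∞ fun x => f x * g x :=
  contDiff_pi.2 fun i => contDiff_pi.2 fun j => ContDiff.sum fun k _ =>
    (contDiff_pi.1 (contDiff_pi.1 hf i) k).mul (contDiff_pi.1 (contDiff_pi.1 hg k) j)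

variable {ι F : Type*} [Fintype ι] [DecidableEq ι] [NormedRing F] [NormedAlgebra ℝ F]
  [FiniteDimensional ℝ F]

/-- A copy of the algebra of square matrices that carries a submultiplicative norm.  The smooth
structures are defined by the entrywise supremum norm, which makes matrices a normed space but not
a normed ring. -/
def OpMatrix (ι F : Type*) := Matrix ι ι F

noncomputable instance : NormedRing (OpMatrix ι F) := Matrix.linftyOpNormedRing

noncomputable instance : NormedAlgebra ℝ (OpMatrix ι F) := Matrix.linftyOpNormedAlgebra

instance : FiniteDimensional ℝ (OpMatrix ι F) :=
  inferInstanceAs (FiniteDimensional ℝ (Matrix ι ι F))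

instance : CompleteSpace (OpMatrix ι F) := FiniteDimensional.complete ℝ _

/-- The identity map between the two normed spaces of matrices. -/
noncomputable def toOpMatrix (ι F : Type*) [Fintype ι] [DecidableEq ι] [NormedRing F]
    [NormedAlgebra ℝ F] [FiniteDimensional ℝ F] : Matrix ι ι F ≃L[ℝ] OpMatrix ι F :=
  LinearEquiv.toContinuousLinearEquiv
    ({ Equiv.refl _ with map_add' := fun _ _ => rfl, map_smul' := fun _ _ => rfl } :
      Matrix ι ι F ≃ₗ[ℝ] OpMatrix ι F)

theorem eventually_isUnit_matrix (g : GLin ι F) : ∀ᶠ M in 𝓝 (g : Matrix ι ι F), IsUnit M :=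
  ((toOpMatrix ι F).continuous.tendsto (g : Matrix ι ι F)).eventually
    (Units.nhds (R := OpMatrix ι F) g)

variable [StarRing F] [StarModule ℝ F] {Φ : Finset (Matrix ι ι F ≃⋆ₐ[ℝ] Matrix ι ι F)}

instance : StarRing (OpMatrix ι F) := inferInstanceAs (StarRing (Matrix ι ι F))

instance : StarModule ℝ (OpMatrix ι F) := inferInstanceAs (StarModule ℝ (Matrix ι ι F))

instance : ContinuousStar (OpMatrix ι F) where
  continuous_star := LinearMap.continuous_of_finiteDimensional
    (starLinearEquiv ℝ (A := OpMatrix ι F)).toLinearMap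

theorem isOpen_identityComponent_formGroup_matrix :
    IsOpen ((identityComponent (formGroup Φ)).subgroupOf (formGroup Φ) : Set (formGroup Φ)) :=
  isOpen_identityComponent_formGroup (A := OpMatrix ι F)

variable {e e' : Matrix ι ι F} {G : Subgroup (GLin ι F)}

theorem exists_contDiffAt_unitary_section (h : IsOppositePair Φ e e') (hG : G ≤ formGroup Φ)
    (hopen : IsOpen (G.subgroupOf (formGroup Φ) : Set (formGroup Φ))) :
    ∃ κ : Matrix ι ι F → Matrix ι ι F, ContDiffAt ℝ ∞ κ 1 ∧
      ∀ᶠ M in 𝓝 (1 : Matrix ι ι F), ∀ g ∈ G, (g : Matrix ι ι F) = M → ∃ k ∈ G,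
        k ∈ unitaryUnits (Matrix ι ι F) ∧ (k : Matrix ι ι F) = κ M ∧ k⁻¹ * g ∈ parabolic e := by
  let κ : OpMatrix ι F → OpMatrix ι F := unitarySection (A := OpMatrix ι F) e e'
  have hκ : ContDiffAt ℝ ∞ κ 1 := contDiffAt_unitarySection (A := OpMatrix ι F) h
  refine ⟨fun M => (toOpMatrix ι F).symm (κ (toOpMatrix ι F M)), ?_, ?_⟩
  · refine (toOpMatrix ι F).symm.contDiff.contDiffAt.comp _ ?_
    exact ContDiffAt.comp (g := κ) (f := toOpMatrix ι F) _ hκ (toOpMatrix ι F).contDiff.contDiffAt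
  · exact ((toOpMatrix ι F).continuous.tendsto 1).eventually
      (exists_mem_coe_eq_unitarySection (A := OpMatrix ι F) h
        (fun τ _ => continuous_starAlgEquiv τ) hG hopen)

end Transfer

section UnitarySections

attribute [local instance] Matrix.normedAddCommGroup Matrix.normedSpace

variable {ι F : Type*} [Fintype ι] [DecidableEq ι] [NormedDivisionRing F] [NormedAlgebra ℝ F]
  [StarRing F] [StarModule ℝ F] [ContinuousStar F] [FiniteDimensional ℝ F] [ConjugationAlgebra F]
  {Φ : Finset (Matrix ι ι F ≃⋆ₐ[ℝ] Matrix ι ι F)} {e e' : Matrix ι ι F} {G : Subgroup (GLin ι F)}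

theorem exists_unitary_inv_mul_mem_parabolic (h : IsOppositePair Φ e e') (hG : G ≤ formGroup Φ)
    (hopen : IsOpen (G.subgroupOf (formGroup Φ) : Set (formGroup Φ))) {g : GLin ι F} (hg : g ∈ G) :
    ∃ k ∈ G, k ∈ unitaryUnits (Matrix ι ι F) ∧ k⁻¹ * g ∈ parabolic e := by
  have hclosed : IsClosed (G : Set (GLin ι F)) :=
    isClosed_of_isOpen_subgroupOf (isClosed_formGroup fun τ _ => continuous_starAlgEquiv τ) hG hopen
  exact exists_mem_unitary_inv_mul_mem_parabolic (A := OpMatrix ι F) isUnit_one_add_star_mul_self h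
    (fun τ _ => continuous_starAlgEquiv τ) hG hopen
    ((isCompact_unitaryUnits isCompact_unitary).inter_left hclosed) hg

theorem exists_contDiffAt_unitary_section_of_mem (h : IsOppositePair Φ e e')
    (hG : G ≤ formGroup Φ) (hopen : IsOpen (G.subgroupOf (formGroup Φ) : Set (formGroup Φ)))
    {g₀ : GLin ι F} (hg₀ : g₀ ∈ G) :
    ∃ κ : Matrix ι ι F → Matrix ι ι F, ContDiffAt ℝ ∞ κ g₀ ∧
      ∀ᶠ M in 𝓝 (g₀ : Matrix ι ι F), ∀ g ∈ G, (g : Matrix ι ι F) = M → ∃ k ∈ G,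
        k ∈ unitaryUnits (Matrix ι ι F) ∧ (k : Matrix ι ι F) = κ M ∧ k⁻¹ * g ∈ parabolic e := by
  obtain ⟨k₀, hk₀G, hk₀, hp₀⟩ := exists_unitary_inv_mul_mem_parabolic h hG hopen hg₀
  obtain ⟨κ, hκ, hκ_sec⟩ := exists_contDiffAt_unitary_section h hG hopen
  set p₀ := k₀⁻¹ * g₀ with hp₀_def
  let shift (M : Matrix ι ι F) : Matrix ι ι F :=
    ((k₀⁻¹ : GLin ι F) : Matrix ι ι F) * M * ((p₀⁻¹ : GLin ι F) : Matrix ι ι F)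
  have hshift : ContDiff ℝ ∞ shift :=
    contDiff_matrix_mul (contDiff_matrix_mul contDiff_const contDiff_id) contDiff_const
  have hshift_one : shift g₀ = 1 := by
    rw [← Units.val_one, ← mul_inv_cancel p₀, Units.val_mul, hp₀_def, Units.val_mul]
  rw [← hshift_one] at hκ hκ_sec
  refine ⟨fun M => (k₀ : Matrix ι ι F) * κ (shift M), ?_, ?_⟩
  · exact (contDiff_matrix_mul contDiff_const contDiff_id).contDiffAt.comp _
      (hκ.comp _ hshift.contDiffAt)
  · filter_upwards [hshift.continuous.continuousAt.eventually hκ_sec] with M hM g hg hgM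
    obtain ⟨k, hkG, hk, hkM, hkP⟩ := hM (k₀⁻¹ * g * p₀⁻¹)
      (mul_mem (mul_mem (inv_mem hk₀G) hg) (inv_mem (mul_mem (inv_mem hk₀G) hg₀)))
      (by rw [Units.val_mul, Units.val_mul, hgM])
    refine ⟨k₀ * k, mul_mem hk₀G hkG, mul_mem hk₀ hk, by rw [Units.val_mul, hkM], ?_⟩
    have hkg : (k₀ * k)⁻¹ * g = k⁻¹ * (k₀⁻¹ * g * p₀⁻¹) * p₀ := by group
    rw [hkg]
    exact mul_mem hkP hp₀

end UnitarySections

section MaximalCompact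

variable {ι F : Type*} [Fintype ι] [DecidableEq ι]

theorem mat_injective [Ring F] {G : Subgroup (GLin ι F)} :
    Function.Injective (mat : G → Matrix ι ι F) :=
  Units.val_injective.comp Subtype.val_injective

theorem mem_maxCompact_iff [Ring F] [StarRing F] {G : Subgroup (GLin ι F)} {g : G} :
    g ∈ maxCompact G ↔ (g : GLin ι F) ∈ unitaryUnits (Matrix ι ι F) := by
  change (star (g : GLin ι F))⁻¹ = g ↔ _
  rw [inv_eq_iff_mul_eq_one]
  refine ⟨fun h => ?_, fun h => Units.ext (Unitary.star_mul_self_of_mem h)⟩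
  exact Unitary.mem_iff.2
    ⟨congrArg Units.val h, congrArg Units.val (mul_eq_one_comm.1 h)⟩

variable [NormedRing F] {G : Subgroup (GLin ι F)}

theorem continuous_mat : Continuous (mat : G → Matrix ι ι F) :=
  Units.continuous_val.comp continuous_subtype_val

theorem isInducing_mat_maxCompact [StarRing F] [ContinuousStar F] :
    IsInducing fun k : maxCompact G => mat (k : G) :=
  isInducing_val_of_mem_unitaryUnits (f := fun k : maxCompact G => ((k : G) : GLin ι F))
    (IsInducing.subtypeVal.comp IsInducing.subtypeVal) fun k => mem_maxCompact_iff.1 k.2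

end MaximalCompact

section Stabilizer

variable {ι F : Type*} [Fintype ι] [Ring F]

theorem dvd_mul_iff_mulVec_eq {e : Matrix ι ι F} (he : IsIdempotentElem e) (m : Matrix ι ι F) :
    e ∣ m * e ↔ ∀ x, e *ᵥ x = x → e *ᵥ (m *ᵥ x) = m *ᵥ x := by
  refine ⟨fun h x hx => ?_, fun h => ⟨m * e, Matrix.mulVec_injective (funext fun x => ?_)⟩⟩
  · rw [← hx, Matrix.mulVec_mulVec x m, Matrix.mulVec_mulVec, mul_eq_self_of_dvd he h]
  · have hx : e *ᵥ (e *ᵥ x) = e *ᵥ x := by rw [Matrix.mulVec_mulVec, he.eq]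
    simpa only [Matrix.mulVec_mulVec] using (h _ hx).symm

theorem stab_eq_parabolic_subgroupOf [DecidableEq ι] {e : Matrix ι ι F} (he : IsIdempotentElem e)
    (G : Subgroup (GLin ι F)) {W : Set (ι → F)} (hW : ∀ x, x ∈ W ↔ e *ᵥ x = x) :
    stab G W = (parabolic e).subgroupOf G := by
  ext g
  have hdvd (a : G) : e ∣ mat a * e ↔ ∀ x ∈ W, mat a *ᵥ x ∈ W := by
    simp only [dvd_mul_iff_mulVec_eq he, hW]
  have hparabolic : g ∈ (parabolic e).subgroupOf G ↔
      (∀ x ∈ W, mat g *ᵥ x ∈ W) ∧ ∀ x ∈ W, mat g⁻¹ *ᵥ x ∈ W :=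
    and_congr (hdvd g) (hdvd g⁻¹)
  rw [hparabolic]
  refine ⟨fun h => ⟨fun x => (h x).2, fun x => ((stab G W).inv_mem h x).2⟩, fun h x => ⟨?_, h.1 x⟩⟩
  have hinv : mat g⁻¹ *ᵥ (mat g *ᵥ x) = x := by simp [mat, Matrix.mulVec_mulVec]
  exact fun hx => hinv ▸ h.2 _ hx

end Stabilizer

section Symmetry

variable {ι F : Type*} [Fintype ι] [DecidableEq ι] [NormedRing F] [StarRing F]
  {e e' : Matrix ι ι F} {G : Subgroup (GLin ι F)}

theorem isSymmetricSubgroup_parabolic (he : IsStarProjection e) (hee' : e * e' = 0)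
    {s : GLin ι F} (hs : s * s = 1) (hs_star : star s = s) (hsG : ∀ g ∈ G, s * g * s ∈ G)
    (hs_comm : ∀ k ∈ G, k ∈ unitaryUnits (Matrix ι ι F) → Commute (k : Matrix ι ι F) e →
      Commute (k : Matrix ι ι F) s)
    (hdich : ∀ k ∈ G, k ∈ unitaryUnits (Matrix ι ι F) → Commute (k : Matrix ι ι F) s →
      Commute (k : Matrix ι ι F) e ∨ (k : Matrix ι ι F) * e = e' * k) :
    IsSymmetricSubgroup (((parabolic e).subgroupOf G).subgroupOf (maxCompact G)) := by
  have hs_unitary := mem_unitaryUnits_of_mul_self hs hs_star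
  have hk (k : maxCompact G) : ((k : G) : GLin ι F) ∈ unitaryUnits (Matrix ι ι F) :=
    mem_maxCompact_iff.1 k.2
  have hmem (k : maxCompact G) :
      k ∈ ((parabolic e).subgroupOf G).subgroupOf (maxCompact G) ↔ Commute (mat (k : G)) e :=
    mem_parabolic_iff_commute he (hk k)
  let f : maxCompact G →* GLin ι F := G.subtype.comp (maxCompact G).subtype
  refine isSymmetricSubgroup_of_conj (f := f) (IsEmbedding.subtypeVal.comp IsEmbedding.subtypeVal)
    hs (fun k => ?_) (Z := {k | mat (k : G) * e = e' * mat (k : G) ∧ e ≠ 0}) ?_ (fun k hkP => ?_)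
    ?_ (fun k hks => ?_)
  · exact ⟨⟨⟨s * f k * s, hsG _ k.1.2⟩, mem_maxCompact_iff.2
      (mul_mem (mul_mem hs_unitary (hk k)) hs_unitary)⟩, rfl⟩
  · have hcont : Continuous fun k : maxCompact G => mat (k : G) :=
      continuous_mat.comp continuous_subtype_val
    exact (isClosed_eq (hcont.mul continuous_const) (continuous_const.mul hcont)).inter
      isClosed_const
  · exact Units.ext (hs_comm _ k.1.2 (hk k) ((hmem k).1 hkP)).eq
  · refine Set.disjoint_left.2 fun k hkP ⟨hkZ, he0⟩ => he0 ?_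
    have heq : e = e' :=
      (k : G).1.isUnit.mul_left_injective (((hmem k).1 hkP).eq.symm.trans hkZ)
    rw [← he.isIdempotentElem.eq]
    nth_rewrite 2 [heq]
    exact hee'
  · obtain hke | hke := hdich _ k.1.2 (hk k) (congrArg Units.val hks.eq)
    · exact Or.inl ((hmem k).2 hke)
    · obtain rfl | he0 := eq_or_ne e 0
      · exact Or.inl ((hmem k).2 (Commute.zero_right _))
      · exact Or.inr ⟨hke, he0⟩

end Symmetry

section Realization

attribute [local instance] Matrix.normedAddCommGroup Matrix.normedSpace

variable {ι F : Type*} [Fintype ι] [DecidableEq ι] [NormedDivisionRing F] [NormedAlgebra ℝ F]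
  [FiniteDimensional ℝ F] [StarRing F] [ContinuousStar F] [ConjugationAlgebra F]
  {Φ : Finset (Matrix ι ι F ≃⋆ₐ[ℝ] Matrix ι ι F)} {e e' : Matrix ι ι F} {G : Subgroup (GLin ι F)}

theorem isCompact_maxCompact (hG : G ≤ formGroup Φ)
    (hopen : IsOpen (G.subgroupOf (formGroup Φ) : Set (formGroup Φ))) :
    IsCompact (maxCompact G : Set G) := by
  have hclosed : IsClosed (G : Set (GLin ι F)) :=
    isClosed_of_isOpen_subgroupOf (isClosed_formGroup fun τ _ => continuous_starAlgEquiv τ) hG hopen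
  have hpreimage : (maxCompact G : Set G) =
      (↑) ⁻¹' (unitaryUnits (Matrix ι ι F) : Set (GLin ι F)) :=
    Set.ext fun _ => mem_maxCompact_iff
  rw [hpreimage]
  exact hclosed.isClosedEmbedding_subtypeVal.isCompact_preimage
    (isCompact_unitaryUnits isCompact_unitary)

variable [StarModule ℝ F]

theorem exists_homeomorph_quotient_parabolic (h : IsOppositePair Φ e e') (hG : G ≤ formGroup Φ)
    (hopen : IsOpen (G.subgroupOf (formGroup Φ) : Set (formGroup Φ))) :
    let P := (parabolic e).subgroupOf G
    ∃ φ : (maxCompact G ⧸ P.subgroupOf (maxCompact G)) ≃ₜ (G ⧸ P),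
      (∀ k : maxCompact G,
        φ (k : maxCompact G ⧸ P.subgroupOf (maxCompact G)) = ((k : G) : G ⧸ P)) ∧
      IsDiffeo (smoothSubQuot (maxCompact G) (P.subgroupOf (maxCompact G))) (smoothQuot G P) φ := by
  refine exists_isDiffeo_of_local_sections isInducing_mat_maxCompact continuous_mat
    mat_injective (QuotientGroup.isQuotientMap_mk _) (QuotientGroup.isQuotientMap_mk _)
    (j := fun k : maxCompact G => (k : G)) continuous_subtype_val contDiff_id (fun _ => rfl) ?_ ?_
  · intro k k'
    rw [QuotientGroup.eq, QuotientGroup.eq, Subgroup.mem_subgroupOf]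
    rfl
  · intro g₀
    obtain ⟨κ, hκ, hκ_sec⟩ := exists_contDiffAt_unitary_section_of_mem h hG hopen g₀.2
    refine ⟨κ, hκ, hκ_sec.mono fun M hM g hgM => ?_⟩
    obtain ⟨k, hkG, hk, hkM, hkP⟩ := hM g g.2 hgM
    refine ⟨⟨⟨k, hkG⟩, mem_maxCompact_iff.2 hk⟩, hkM, ?_⟩
    rw [QuotientGroup.eq]
    exact hkP

theorem isPretransitive_maxCompact (h : IsOppositePair Φ e e') (hG : G ≤ formGroup Φ)
    (hopen : IsOpen (G.subgroupOf (formGroup Φ) : Set (formGroup Φ))) :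
    MulAction.IsPretransitive (maxCompact G) (G ⧸ (parabolic e).subgroupOf G) := by
  refine (MulAction.isPretransitive_iff_base (QuotientGroup.mk 1)).2 fun x => ?_
  obtain ⟨g, rfl⟩ := QuotientGroup.mk_surjective x
  obtain ⟨k, hkG, hk, hkP⟩ := exists_unitary_inv_mul_mem_parabolic h hG hopen g.2
  refine ⟨⟨⟨k, hkG⟩, mem_maxCompact_iff.2 hk⟩, ?_⟩
  change ((_ * 1 : G) : G ⧸ (parabolic e).subgroupOf G) = g
  rw [mul_one, QuotientGroup.eq]
  exact hkP

theorem isCompactSymmetricRealization_of_isOppositePair (h : IsOppositePair Φ e e')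
    (hG : G ≤ formGroup Φ) (hopen : IsOpen (G.subgroupOf (formGroup Φ) : Set (formGroup Φ)))
    {s : GLin ι F} (hs : s * s = 1) (hs_star : star s = s) (hsG : ∀ g ∈ G, s * g * s ∈ G)
    (hs_comm : ∀ x : Matrix ι ι F, Commute x e → Commute x e' → Commute x s)
    (hdich : ∀ k ∈ G, k ∈ unitaryUnits (Matrix ι ι F) → Commute (k : Matrix ι ι F) s →
      Commute (k : Matrix ι ι F) e ∨ (k : Matrix ι ι F) * e = e' * k)
    {W W' : Set (ι → F)} (hW : ∀ x, x ∈ W ↔ e *ᵥ x = x) (hW' : ∀ x, x ∈ W' ↔ e' *ᵥ x = x) :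
    IsCompactSymmetricRealization G (stab G W) (stab G W ⊓ stab G W') := by
  rw [stab_eq_parabolic_subgroupOf h.left.isIdempotentElem G hW,
    stab_eq_parabolic_subgroupOf h.right.isIdempotentElem G hW']
  refine ⟨isCompact_maxCompact hG hopen, isPretransitive_maxCompact h hG hopen, ?_,
    isSymmetricSubgroup_parabolic h.left h.mul_eq_zero hs hs_star hsG (fun k hkG hk hke => ?_)
      hdich,
    exists_homeomorph_quotient_parabolic h hG hopen⟩
  · refine le_antisymm (fun k ⟨hkP, hk⟩ => ⟨⟨hkP, ?_⟩, hk⟩) (inf_le_inf_right _ inf_le_left)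
    have hk' := mem_maxCompact_iff.1 hk
    exact mem_parabolic_of_commute
      (h.commute_right hk' (hG k.2) (commute_of_mem_parabolic h.left hk' hkP))
  · exact hs_comm _ hke (h.commute_right hk (hG hkG) hke)

end Realization

section Reflection

variable {A : Type*} [Ring A] [StarRing A] {f : A}

/-- The orthogonal reflection `2 f - 1` that fixes the range of the projection `f`. -/
def reflection (hf : IsStarProjection f) : Aˣ :=
  Unitary.toUnits ⟨2 * f - 1, hf.two_mul_sub_one_mem_unitary⟩

theorem coe_reflection (hf : IsStarProjection f) : (reflection hf : A) = 2 * f - 1 := rfl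

theorem star_reflection (hf : IsStarProjection f) : star (reflection hf) = reflection hf :=
  Units.ext <| by
    simp only [Units.coe_star, coe_reflection, two_mul, star_sub, star_add,
      hf.isSelfAdjoint.star_eq, star_one]

theorem reflection_mul_self (hf : IsStarProjection f) : reflection hf * reflection hf = 1 := by
  nth_rw 1 [← star_reflection hf]
  exact Units.ext (Unitary.star_mul_self_of_mem hf.two_mul_sub_one_mem_unitary)

variable [Algebra ℝ A]

theorem commute_reflection_iff (hf : IsStarProjection f) {x : A} :
    Commute x (reflection hf) ↔ Commute x f := by
  rw [coe_reflection]
  refine ⟨fun h => ?_, fun h => ((Commute.ofNat_right x 2).mul_right h).sub_right (.one_right x)⟩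
  have hf_eq : f = (2⁻¹ : ℝ) • ((2 * f - 1) + 1) := by
    rw [sub_add_cancel, two_mul, ← two_smul ℝ f, inv_smul_smul₀ two_ne_zero]
  rw [hf_eq]
  exact (h.add_right (.one_right x)).smul_right _

theorem reflection_conj_mem_formGroup {Φ : Finset (A ≃⋆ₐ[ℝ] A)} (hf : IsStarProjection f)
    (hΦ : ∀ τ ∈ Φ, τ f = f ∨ τ f = 1 - f) {g : Aˣ} (hg : g ∈ formGroup Φ) :
    reflection hf * g * reflection hf ∈ formGroup Φ := by
  intro τ hτ
  have hs : (reflection hf : A) * reflection hf = 1 := congrArg Units.val (reflection_mul_self hf)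
  have hs_star : star (reflection hf : A) = reflection hf :=
    congrArg Units.val (star_reflection hf)
  have hτs : τ (reflection hf) = reflection hf ∨ τ (reflection hf) = -(reflection hf : A) := by
    simp only [coe_reflection, map_sub, map_mul, map_ofNat, map_one]
    refine (hΦ τ hτ).imp (fun h => by rw [h]) fun h => ?_
    rw [h]
    noncomm_ring
  have hcancel : τ (reflection hf) * τ (star (g : A)) * τ (reflection hf) =
      reflection hf * τ (star (g : A)) * reflection hf := by
    rcases hτs with h | h <;> simp only [h, neg_mul, mul_neg, neg_neg]
  calc τ (star ((reflection hf * g * reflection hf : Aˣ) : A)) *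
        (reflection hf * g * reflection hf : Aˣ)
      = τ (reflection hf) * τ (star (g : A)) * τ (reflection hf) *
          (reflection hf * g * reflection hf) := by
        simp only [Units.val_mul, star_mul, hs_star, map_mul, mul_assoc]
    _ = reflection hf * (τ (star (g : A)) * (reflection hf * reflection hf) * g) *
          reflection hf := by rw [hcancel]; noncomm_ring
    _ = 1 := by rw [hs, mul_one, hg τ hτ, mul_one, hs]

theorem isOppositePair_one_sub {Φ : Finset (A ≃⋆ₐ[ℝ] A)} {e : A} (he : IsStarProjection e)
    (hΦ : ∀ τ ∈ Φ, τ e = 1 - e) : IsOppositePair Φ e (1 - e) where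
  left := he
  right := he.one_sub
  mul_eq_zero := he.mul_one_sub_self
  map_left := hΦ
  map_right τ hτ := by rw [map_sub, map_one, hΦ τ hτ, sub_sub_cancel]
  nonempty_or_add_eq_one := Or.inr (add_sub_cancel e 1)

end Reflection

section Forms

theorem formGroup_empty {A : Type*} [Ring A] [StarRing A] [Algebra ℝ A] :
    formGroup (∅ : Finset (A ≃⋆ₐ[ℝ] A)) = ⊤ :=
  top_unique fun _ _ _ hτ => absurd hτ (Finset.notMem_empty _)

variable {ι F : Type*} [Fintype ι] [DecidableEq ι]

theorem sesqGroup_eq_formGroup [Ring F] [StarRing F] [Algebra ℝ F]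
    (S : unitary (Matrix ι ι F)) :
    sesqGroup (S : Matrix ι ι F) = formGroup {Unitary.conjStarAlgAut ℝ _ (star S)} := by
  ext g
  change star (g : Matrix ι ι F) * S * g = S ↔ ∀ τ ∈ _, _
  simp only [Finset.mem_singleton, forall_eq, Unitary.conjStarAlgAut_star_apply]
  rw [← Unitary.mul_right_inj (star S), Unitary.coe_star, Unitary.coe_star_mul_self]
  simp only [mul_assoc]

/-- The entrywise complex conjugation of matrices. -/
noncomputable def conjEntries (ι F : Type*) [Fintype ι] [DecidableEq ι] [RCLike F] :
    Matrix ι ι F ≃⋆ₐ[ℝ] Matrix ι ι F :=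
  .ofAlgEquiv RCLike.conjAe.mapMatrix fun _ => rfl

theorem mul_mul_mem_detOne [CommRing F] {s g : GLin ι F} (hs : s * s = 1)
    (hg : g ∈ detOne ι F) : s * g * s ∈ detOne ι F := by
  have hg' : (g : Matrix ι ι F).det = 1 := hg
  change ((s * g * s : GLin ι F) : Matrix ι ι F).det = 1
  rw [Units.val_mul, Units.val_mul, Matrix.det_mul, Matrix.det_mul, hg', mul_one,
    ← Matrix.det_mul, ← Units.val_mul, hs, Units.val_one, Matrix.det_one]

variable [RCLike F]

theorem conjEntries_apply (M : Matrix ι ι F) : conjEntries ι F M = M.map star := rfl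

/-- The automorphism `M ↦ S⁻¹ M̄ S`: the elements `g` of `bilinGroup S` are those for which it maps
`star g` to `g⁻¹`. -/
noncomputable def bilinAut (S : unitary (Matrix ι ι F)) : Matrix ι ι F ≃⋆ₐ[ℝ] Matrix ι ι F :=
  (conjEntries ι F).trans (Unitary.conjStarAlgAut ℝ _ (star S))

theorem bilinAut_apply (S : unitary (Matrix ι ι F)) (M : Matrix ι ι F) :
    bilinAut S M = star (S : Matrix ι ι F) * conjEntries ι F M * S :=
  Unitary.conjStarAlgAut_star_apply (S := ℝ) S _

theorem bilinGroup_eq_formGroup (S : unitary (Matrix ι ι F)) :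
    bilinGroup (S : Matrix ι ι F) = formGroup {bilinAut S} := by
  ext g
  have hg : conjEntries ι F (star (g : Matrix ι ι F)) = (g : Matrix ι ι F)ᵀ :=
    Matrix.ext fun i j => star_star _
  change (g : Matrix ι ι F)ᵀ * S * g = S ↔ ∀ τ ∈ _, _
  simp only [Finset.mem_singleton, forall_eq, bilinAut_apply, hg]
  rw [← Unitary.mul_right_inj (star S), Unitary.coe_star, Unitary.coe_star_mul_self]
  simp only [mul_assoc]

theorem isOpen_bilinGroup_inf_detOne {S : Matrix ι ι F} (hS : IsUnit S.det) :
    IsOpen ((bilinGroup S ⊓ detOne ι F).subgroupOf (bilinGroup S) : Set (bilinGroup S)) := by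
  have hdet : Continuous fun g : GLin ι F => (g : Matrix ι ι F).det :=
    Units.continuous_val.matrix_det
  have hne : ∀ᶠ g : GLin ι F in 𝓝 1, (g : Matrix ι ι F).det ≠ -1 :=
    hdet.continuousAt.eventually_ne <| by
      rw [Units.val_one, Matrix.det_one]
      exact fun h => one_ne_zero (self_eq_neg.1 h)
  refine isOpen_subgroupOf_iff.2 (hne.mono fun g hg_ne hg => ⟨hg, ?_⟩)
  have hsq := congrArg Matrix.det (show (g : Matrix ι ι F)ᵀ * S * g = S from hg)
  rw [Matrix.det_mul, Matrix.det_mul, Matrix.det_transpose, mul_right_comm,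
    hS.mul_eq_right] at hsq
  exact (mul_self_eq_one_iff.1 hsq).resolve_right hg_ne

end Forms

section Blocks

attribute [local instance] Matrix.normedAddCommGroup Matrix.normedSpace

variable {p q : ℕ} {F : Type*}

/-- The orthogonal projection onto the span of the first `p` standard basis vectors. -/
def blockProj (p q : ℕ) (F : Type*) [Ring F] : Matrix (Fin p ⊕ Fin q) (Fin p ⊕ Fin q) F :=
  Matrix.fromBlocks 1 0 0 0

theorem isIdempotentElem_blockProj [Ring F] : IsIdempotentElem (blockProj p q F) := by
  simp [IsIdempotentElem, blockProj, Matrix.fromBlocks_multiply]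

theorem isStarProjection_blockProj [Ring F] [StarRing F] : IsStarProjection (blockProj p q F) where
  isIdempotentElem := isIdempotentElem_blockProj
  isSelfAdjoint := by
    simp [IsSelfAdjoint, blockProj, Matrix.star_eq_conjTranspose,
      Matrix.fromBlocks_conjTranspose]

theorem one_sub_blockProj [Ring F] : 1 - blockProj p q F = Matrix.fromBlocks 0 0 0 1 := by
  rw [sub_eq_iff_eq_add, blockProj, Matrix.fromBlocks_add, ← Matrix.fromBlocks_one]
  simp only [zero_add, add_zero]

theorem blockProj_mulVec [Ring F] (x : Fin p ⊕ Fin q → F) :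
    blockProj p q F *ᵥ x = Sum.elim (x ∘ Sum.inl) 0 := by
  simp [blockProj, Matrix.fromBlocks_mulVec]

theorem mem_stdFirst_iff [Ring F] (x : Fin p ⊕ Fin q → F) :
    x ∈ stdFirst p q F ↔ blockProj p q F *ᵥ x = x := by
  simp [blockProj_mulVec, stdFirst, funext_iff, eq_comm]

theorem mem_stdLast_iff [Ring F] (x : Fin p ⊕ Fin q → F) :
    x ∈ stdLast p q F ↔ (1 - blockProj p q F) *ᵥ x = x := by
  rw [Matrix.sub_mulVec, Matrix.one_mulVec, sub_eq_self]
  simp [blockProj_mulVec, stdLast, funext_iff]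

section Realization

variable [NormedDivisionRing F] [NormedAlgebra ℝ F] [StarRing F] [StarModule ℝ F]
  [ContinuousStar F] [FiniteDimensional ℝ F] [ConjugationAlgebra F]
  {Φ : Finset (Matrix (Fin p ⊕ Fin q) (Fin p ⊕ Fin q) F ≃⋆ₐ[ℝ]
    Matrix (Fin p ⊕ Fin q) (Fin p ⊕ Fin q) F)}

theorem isBlockRealization_of_isOpen {G : Subgroup (GLin (Fin p ⊕ Fin q) F)}
    (hΦ : ∀ τ ∈ Φ, τ (blockProj p q F) = 1 - blockProj p q F) (hG : G ≤ formGroup Φ)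
    (hopen : IsOpen (G.subgroupOf (formGroup Φ) : Set (formGroup Φ)))
    (hrefl : ∀ g ∈ G,
      reflection isStarProjection_blockProj * g * reflection isStarProjection_blockProj ∈ G) :
    IsBlockRealization G :=
  isCompactSymmetricRealization_of_isOppositePair
    (isOppositePair_one_sub isStarProjection_blockProj hΦ) hG hopen
    (reflection_mul_self _) (star_reflection _) hrefl
    (fun _ h _ => (commute_reflection_iff _).2 h)
    (fun _ _ _ h => Or.inl ((commute_reflection_iff _).1 h)) mem_stdFirst_iff mem_stdLast_iff

theorem isBlockRealization_formGroup
    (hΦ : ∀ τ ∈ Φ, τ (blockProj p q F) = 1 - blockProj p q F) :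
    IsBlockRealization (formGroup Φ) :=
  isBlockRealization_of_isOpen hΦ le_rfl (by simp) fun _ hg =>
    reflection_conj_mem_formGroup _ (fun τ hτ => Or.inr (hΦ τ hτ)) hg

theorem isBlockRealization_top (p q : ℕ) :
    IsBlockRealization (⊤ : Subgroup (GLin (Fin p ⊕ Fin q) F)) := by
  rw [← formGroup_empty]
  exact isBlockRealization_formGroup fun τ hτ => absurd hτ (Finset.notMem_empty τ)

end Realization

section Lagrangian

variable {n : ℕ}

theorem formJ_mem_unitary [Ring F] [StarRing F] : formJ n F ∈ unitary (Matrix _ _ F) := by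
  simp [Unitary.mem_iff, formJ, Matrix.star_eq_conjTranspose, Matrix.fromBlocks_conjTranspose,
    Matrix.fromBlocks_multiply]

theorem formD_mem_unitary [Ring F] [StarRing F] : formD n F ∈ unitary (Matrix _ _ F) := by
  simp [Unitary.mem_iff, formD, Matrix.star_eq_conjTranspose, Matrix.fromBlocks_conjTranspose,
    Matrix.fromBlocks_multiply]

theorem star_formJ_mul_blockProj_mul_formJ [Ring F] [StarRing F] :
    star (formJ n F) * blockProj n n F * formJ n F = 1 - blockProj n n F := by
  rw [one_sub_blockProj]
  simp [formJ, blockProj, Matrix.star_eq_conjTranspose,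
    Matrix.fromBlocks_conjTranspose, Matrix.fromBlocks_multiply]

theorem star_formD_mul_blockProj_mul_formD [Ring F] [StarRing F] :
    star (formD n F) * blockProj n n F * formD n F = 1 - blockProj n n F := by
  rw [one_sub_blockProj]
  simp [formD, blockProj, Matrix.star_eq_conjTranspose,
    Matrix.fromBlocks_conjTranspose, Matrix.fromBlocks_multiply]

theorem isBlockRealization_sesqGroup [NormedDivisionRing F] [NormedAlgebra ℝ F] [StarRing F]
    [StarModule ℝ F] [ContinuousStar F] [FiniteDimensional ℝ F] [ConjugationAlgebra F]
    {S : Matrix (Fin n ⊕ Fin n) (Fin n ⊕ Fin n) F} (hS : S ∈ unitary (Matrix _ _ F))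
    (hSe : star S * blockProj n n F * S = 1 - blockProj n n F) :
    IsBlockRealization (sesqGroup S) := by
  rw [sesqGroup_eq_formGroup ⟨S, hS⟩]
  refine isBlockRealization_formGroup fun τ hτ => ?_
  rw [Finset.mem_singleton.1 hτ, Unitary.conjStarAlgAut_star_apply]
  exact hSe

variable [RCLike F]

theorem conjEntries_blockProj : conjEntries _ F (blockProj p q F) = blockProj p q F := by
  simp [conjEntries_apply, blockProj, Matrix.fromBlocks_map]

theorem bilinAut_blockProj {S : unitary (Matrix (Fin n ⊕ Fin n) (Fin n ⊕ Fin n) F)}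
    (hSe : star (S : Matrix _ _ F) * blockProj n n F * (S : Matrix _ _ F) =
      1 - blockProj n n F) :
    ∀ τ ∈ ({bilinAut S} : Finset _), τ (blockProj n n F) = 1 - blockProj n n F := by
  intro τ hτ
  rw [Finset.mem_singleton.1 hτ, bilinAut_apply, conjEntries_blockProj, hSe]

theorem isBlockRealization_bilinGroup {S : Matrix (Fin n ⊕ Fin n) (Fin n ⊕ Fin n) F}
    (hS : S ∈ unitary (Matrix _ _ F))
    (hSe : star S * blockProj n n F * S = 1 - blockProj n n F) :
    IsBlockRealization (bilinGroup S) := by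
  rw [bilinGroup_eq_formGroup ⟨S, hS⟩]
  exact isBlockRealization_formGroup (bilinAut_blockProj (S := ⟨S, hS⟩) hSe)

theorem isBlockRealization_bilinGroup_inf_detOne
    {S : Matrix (Fin n ⊕ Fin n) (Fin n ⊕ Fin n) F} (hS : S ∈ unitary (Matrix _ _ F))
    (hSe : star S * blockProj n n F * S = 1 - blockProj n n F) :
    IsBlockRealization (bilinGroup S ⊓ detOne _ F) := by
  have hΦ := bilinAut_blockProj (S := ⟨S, hS⟩) hSe
  have hform := bilinGroup_eq_formGroup ⟨S, hS⟩
  refine isBlockRealization_of_isOpen hΦ (inf_le_left.trans hform.le) ?_ fun g hg =>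
    ⟨?_, mul_mul_mem_detOne (reflection_mul_self _) hg.2⟩
  · rw [← hform]
    exact isOpen_bilinGroup_inf_detOne
      ((Matrix.isUnit_iff_isUnit_det _).1 (Unitary.isUnit_coe (U := ⟨S, hS⟩)))
  · rw [hform] at hg ⊢
    exact reflection_conj_mem_formGroup _ (fun τ hτ => Or.inr (hΦ τ hτ)) hg.1

end Lagrangian

end Blocks

section Quadrics

attribute [local instance] Matrix.normedAddCommGroup Matrix.normedSpace

open scoped ComplexOrder

variable {ι F : Type*} [Fintype ι] [RCLike F] {w w' : ι → F}

/-- The orthogonal projection onto the line spanned by `w`. -/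
noncomputable def lineProj (w : ι → F) : Matrix ι ι F :=
  (star w ⬝ᵥ w)⁻¹ • Matrix.vecMulVec w (star w)

theorem lineProj_mulVec (w x : ι → F) :
    lineProj w *ᵥ x = ((star w ⬝ᵥ w)⁻¹ * (star w ⬝ᵥ x)) • w := by
  rw [lineProj, Matrix.smul_mulVec, Matrix.vecMulVec_mulVec, op_smul_eq_smul, smul_smul]

theorem lineProj_mulVec_self (w : ι → F) : lineProj w *ᵥ w = w := by
  obtain rfl | hw := eq_or_ne w 0
  · exact Matrix.mulVec_zero _
  · rw [lineProj_mulVec, inv_mul_cancel₀ (dotProduct_star_self_eq_zero.not.2 hw), one_smul]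

theorem lineProj_mul_lineProj (h : star w ⬝ᵥ w' = 0) : lineProj w * lineProj w' = 0 := by
  simp only [lineProj, Matrix.smul_mul, Matrix.mul_smul, Matrix.vecMulVec_mul_vecMulVec, h,
    zero_smul, Matrix.vecMulVec_zero, smul_zero]

theorem isStarProjection_lineProj (w : ι → F) : IsStarProjection (lineProj w) where
  isIdempotentElem := Matrix.mulVec_injective <| funext fun x => by
    rw [← Matrix.mulVec_mulVec, lineProj_mulVec w x, Matrix.mulVec_smul, lineProj_mulVec_self]
  isSelfAdjoint := by
    rw [IsSelfAdjoint, lineProj, star_smul, star_inv₀, Matrix.star_eq_conjTranspose,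
      Matrix.conjTranspose_vecMulVec, star_star, ← Matrix.star_dotProduct]

theorem mem_line_iff (w x : ι → F) : x ∈ line w ↔ lineProj w *ᵥ x = x := by
  refine ⟨?_, fun h => ⟨_, h.symm.trans (lineProj_mulVec w x)⟩⟩
  rintro ⟨c, rfl⟩
  rw [Matrix.mulVec_smul, lineProj_mulVec_self]

theorem lineProj_smul {c : F} (hc : c ≠ 0) (w : ι → F) : lineProj (c • w) = lineProj w := by
  have hc' : star c ≠ 0 := star_ne_zero.2 hc
  simp only [lineProj, star_smul, Matrix.vecMulVec_smul, Matrix.smul_vecMulVec, smul_dotProduct,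
    dotProduct_smul, smul_smul, smul_eq_mul]
  congr 1
  field_simp

variable [DecidableEq ι]

theorem mul_lineProj_mul_star {u : Matrix ι ι F} (hu : u ∈ unitary (Matrix ι ι F)) (w : ι → F) :
    u * lineProj w * star u = lineProj (u *ᵥ w) := by
  have hnorm : star (u *ᵥ w) ⬝ᵥ (u *ᵥ w) = star w ⬝ᵥ w := by
    rw [Matrix.star_mulVec, ← Matrix.dotProduct_mulVec, Matrix.mulVec_mulVec,
      ← Matrix.star_eq_conjTranspose, Unitary.star_mul_self_of_mem hu, Matrix.one_mulVec]
  rw [lineProj, lineProj, hnorm, Matrix.mul_smul, Matrix.smul_mul, Matrix.mul_vecMulVec,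
    Matrix.vecMulVec_mul, Matrix.star_mulVec, Matrix.star_eq_conjTranspose]

theorem conjEntries_lineProj (w : ι → F) : conjEntries ι F (lineProj w) = lineProj (star w) := by
  have hnorm : star (star w ⬝ᵥ w) = star (star w) ⬝ᵥ star w := by
    rw [Matrix.star_dotProduct, star_star, star_star, dotProduct_comm]
  rw [conjEntries_apply, lineProj, lineProj, ← hnorm]
  ext i j
  simp [Matrix.vecMulVec_apply]

/-- Nonzero orthogonal vectors exchanged by the antilinear map `x ↦ S⁻¹ x̄`.  They span opposite
isotropic lines for the bilinear form of `S`. -/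
structure IsIsotropicPair (S : unitary (Matrix ι ι F)) (w w' : ι → F) : Prop where
  ne_zero : w ≠ 0
  conj_left : star (S : Matrix ι ι F) *ᵥ star w = w'
  conj_right : star (S : Matrix ι ι F) *ᵥ star w' = w
  orthogonal : star w ⬝ᵥ w' = 0

variable {S : unitary (Matrix ι ι F)}

theorem bilinAut_lineProj (S : unitary (Matrix ι ι F)) (w : ι → F) :
    bilinAut S (lineProj w) = lineProj (star (S : Matrix ι ι F) *ᵥ star w) := by
  rw [bilinAut_apply, conjEntries_lineProj, ← mul_lineProj_mul_star (Unitary.star_mem S.2),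
    star_star]

theorem bilinAut_mulVec (S : unitary (Matrix ι ι F)) (M : Matrix ι ι F) (w : ι → F) :
    bilinAut S M *ᵥ (star (S : Matrix ι ι F) *ᵥ star w) =
      star (S : Matrix ι ι F) *ᵥ star (M *ᵥ w) := by
  rw [bilinAut_apply, Matrix.mulVec_mulVec, mul_assoc, Unitary.mul_star_self_of_mem S.2, mul_one,
    ← Matrix.mulVec_mulVec]
  congr 1
  ext i
  simp [conjEntries_apply, Matrix.mulVec, dotProduct]

namespace IsIsotropicPair

theorem isOppositePair (h : IsIsotropicPair S w w') :
    IsOppositePair {bilinAut S} (lineProj w) (lineProj w') where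
  left := isStarProjection_lineProj w
  right := isStarProjection_lineProj w'
  mul_eq_zero := lineProj_mul_lineProj h.orthogonal
  map_left τ hτ := by rw [Finset.mem_singleton.1 hτ, bilinAut_lineProj, h.conj_left]
  map_right τ hτ := by rw [Finset.mem_singleton.1 hτ, bilinAut_lineProj, h.conj_right]
  nonempty_or_add_eq_one := Or.inl (Finset.singleton_nonempty _)

theorem isStarProjection_add (h : IsIsotropicPair S w w') :
    IsStarProjection (lineProj w + lineProj w') :=
  h.isOppositePair.left.add h.isOppositePair.right h.isOppositePair.mul_eq_zero

theorem orthogonal_symm (h : IsIsotropicPair S w w') : star w' ⬝ᵥ w = 0 := by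
  rw [← star_eq_zero, Matrix.star_dotProduct, h.orthogonal, star_zero, star_zero]

theorem dotProduct_add (h : IsIsotropicPair S w w') (a b c d : F) :
    star (a • w + b • w') ⬝ᵥ (c • w + d • w') =
      star a * c * (star w ⬝ᵥ w) + star b * d * (star w' ⬝ᵥ w') := by
  simp only [star_add, star_smul, add_dotProduct, _root_.dotProduct_add, smul_dotProduct,
    dotProduct_smul, h.orthogonal, h.orthogonal_symm, smul_eq_mul]
  ring

theorem exists_mulVec_eq (h : IsIsotropicPair S w w') {k : Matrix ι ι F}
    (hk : Commute k (lineProj w + lineProj w')) : ∃ a b : F, k *ᵥ w = a • w + b • w' := by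
  have hfw : (lineProj w + lineProj w') *ᵥ w = w := by
    rw [Matrix.add_mulVec, lineProj_mulVec_self, lineProj_mulVec w', h.orthogonal_symm, mul_zero,
      zero_smul, add_zero]
  refine ⟨(star w ⬝ᵥ w)⁻¹ * (star w ⬝ᵥ (k *ᵥ w)), (star w' ⬝ᵥ w')⁻¹ * (star w' ⬝ᵥ (k *ᵥ w)), ?_⟩
  rw [← lineProj_mulVec, ← lineProj_mulVec, ← Matrix.add_mulVec, Matrix.mulVec_mulVec, ← hk.eq,
    ← Matrix.mulVec_mulVec, hfw]

theorem eq_zero_or_eq_zero (h : IsIsotropicPair S w w') {k : Matrix ι ι F}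
    (hk : k ∈ unitary (Matrix ι ι F)) {a b : F} (hkw : k *ᵥ w = a • w + b • w')
    (hkw' : k *ᵥ w' = star b • w + star a • w') : a = 0 ∨ b = 0 := by
  have hkk : star (k *ᵥ w) ⬝ᵥ (k *ᵥ w') = 0 := by
    rw [Matrix.star_mulVec, ← Matrix.dotProduct_mulVec, Matrix.mulVec_mulVec,
      ← Matrix.star_eq_conjTranspose, Unitary.star_mul_self_of_mem hk, Matrix.one_mulVec,
      h.orthogonal]
  have hpos : 0 < star w ⬝ᵥ w + star w' ⬝ᵥ w' :=
    add_pos_of_pos_of_nonneg (Matrix.dotProduct_star_self_pos_iff.2 h.ne_zero)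
      (dotProduct_star_self_nonneg w')
  rw [hkw, hkw', h.dotProduct_add] at hkk
  have hab : star (a * b) * (star w ⬝ᵥ w + star w' ⬝ᵥ w') = 0 := by
    rw [star_mul, ← hkk]
    ring
  exact mul_eq_zero.1 (star_eq_zero.1 ((mul_eq_zero.1 hab).resolve_right hpos.ne'))

theorem commute_or_mul_eq (h : IsIsotropicPair S w w') {k : Matrix ι ι F}
    (hk : k ∈ unitary (Matrix ι ι F)) (hkS : bilinAut S k = k)
    (hkf : Commute k (lineProj w + lineProj w')) :
    Commute k (lineProj w) ∨ k * lineProj w = lineProj w' * k := by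
  obtain ⟨a, b, hkw⟩ := h.exists_mulVec_eq hkf
  have hkw' : k *ᵥ w' = star b • w + star a • w' := by
    rw [← hkS, ← h.conj_left, bilinAut_mulVec, hkw, star_add, star_smul, star_smul,
      Matrix.mulVec_add, Matrix.mulVec_smul, Matrix.mulVec_smul, h.conj_left, h.conj_right,
      add_comm]
  have hconj {u : ι → F} (hu : lineProj (k *ᵥ w) = lineProj u) :
      k * lineProj w = lineProj u * k := by
    rw [← hu, ← mul_lineProj_mul_star hk, mul_assoc _ (star k), Unitary.star_mul_self_of_mem hk,
      mul_one]
  have hkw_ne : k *ᵥ w ≠ 0 := fun h0 => h.ne_zero <| by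
    rw [← Matrix.one_mulVec w, ← Unitary.star_mul_self_of_mem hk, ← Matrix.mulVec_mulVec, h0,
      Matrix.mulVec_zero]
  have hab : a = 0 ∨ b = 0 := h.eq_zero_or_eq_zero hk hkw hkw'
  rcases hab with rfl | rfl
  · rw [zero_smul, zero_add] at hkw
    exact Or.inr (hconj (by rw [hkw, lineProj_smul (left_ne_zero_of_smul (hkw ▸ hkw_ne))]))
  · rw [zero_smul, add_zero] at hkw
    exact Or.inl (hconj (by rw [hkw, lineProj_smul (left_ne_zero_of_smul (hkw ▸ hkw_ne))]))

end IsIsotropicPair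

section Realization

theorem isCompactSymmetricRealization_of_isIsotropicPair (h : IsIsotropicPair S w w')
    {G : Subgroup (GLin ι F)} (hG : G ≤ formGroup {bilinAut S})
    (hopen : IsOpen (G.subgroupOf (formGroup {bilinAut S}) : Set (formGroup {bilinAut S})))
    (hrefl : ∀ g ∈ G,
      reflection h.isStarProjection_add * g * reflection h.isStarProjection_add ∈ G) :
    IsCompactSymmetricRealization G (stab G (line w)) (stab G (line w) ⊓ stab G (line w')) :=
  isCompactSymmetricRealization_of_isOppositePair h.isOppositePair hG hopen
    (reflection_mul_self _) (star_reflection _) hrefl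
    (fun _ he he' => (commute_reflection_iff _).2 (he.add_right he'))
    (fun _ hkG hk hks => h.commute_or_mul_eq hk
      ((mem_formGroup_iff_of_mem_unitary hk).1 (hG hkG) _
        (Finset.mem_singleton_self _)) ((commute_reflection_iff _).1 hks))
    (mem_line_iff w) (mem_line_iff w')

theorem isOpen_bilinGroup_inf_detOne_subgroupOf_formGroup (S : unitary (Matrix ι ι F)) :
    IsOpen ((bilinGroup (S : Matrix ι ι F) ⊓ detOne ι F).subgroupOf (formGroup {bilinAut S}) :
      Set (formGroup {bilinAut S})) := by
  rw [← bilinGroup_eq_formGroup]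
  exact isOpen_bilinGroup_inf_detOne
    ((Matrix.isUnit_iff_isUnit_det _).1 (Unitary.isUnit_coe (U := S)))

theorem reflection_conj_mem_bilinGroup_inf_detOne (h : IsIsotropicPair S w w') {g : GLin ι F}
    (hg : g ∈ bilinGroup (S : Matrix ι ι F) ⊓ detOne ι F) :
    reflection h.isStarProjection_add * g * reflection h.isStarProjection_add ∈
      bilinGroup (S : Matrix ι ι F) ⊓ detOne ι F := by
  refine ⟨?_, mul_mul_mem_detOne (reflection_mul_self _) hg.2⟩
  rw [bilinGroup_eq_formGroup] at hg ⊢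
  refine reflection_conj_mem_formGroup _ (fun τ hτ => Or.inl ?_) hg.1
  rw [map_add, h.isOppositePair.map_left τ hτ, h.isOppositePair.map_right τ hτ, add_comm]

theorem isCompactSymmetricRealization_bilinGroup_inf_detOne (h : IsIsotropicPair S w w') :
    IsCompactSymmetricRealization (bilinGroup (S : Matrix ι ι F) ⊓ detOne ι F)
      (stab _ (line w)) (stab _ (line w) ⊓ stab _ (line w')) :=
  isCompactSymmetricRealization_of_isIsotropicPair h
    (inf_le_left.trans (bilinGroup_eq_formGroup S).le)
    (isOpen_bilinGroup_inf_detOne_subgroupOf_formGroup S)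
    fun _ => reflection_conj_mem_bilinGroup_inf_detOne h

theorem isOpen_identityComponent_bilinGroup_inf_detOne (S : unitary (Matrix ι ι F)) :
    IsOpen ((identityComponent (bilinGroup (S : Matrix ι ι F) ⊓ detOne ι F)).subgroupOf
      (formGroup {bilinAut S}) : Set (formGroup {bilinAut S})) := by
  have hform : IsOpen ((identityComponent (formGroup {bilinAut S})).subgroupOf
      (formGroup {bilinAut S}) : Set (formGroup {bilinAut S})) :=
    isOpen_identityComponent_formGroup_matrix
  exact isOpen_identityComponent_subgroupOf hform
    (isOpen_bilinGroup_inf_detOne_subgroupOf_formGroup S)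

theorem reflection_conj_mem_identityComponent (h : IsIsotropicPair S w w') {g : GLin ι F}
    (hg : g ∈ identityComponent (bilinGroup (S : Matrix ι ι F) ⊓ detOne ι F)) :
    reflection h.isStarProjection_add * g * reflection h.isStarProjection_add ∈
      identityComponent (bilinGroup (S : Matrix ι ι F) ⊓ detOne ι F) :=
  map_mem_identityComponent
    (f := fun x => reflection h.isStarProjection_add * x * reflection h.isStarProjection_add)
    (by fun_prop) (by rw [mul_one, reflection_mul_self])
    (fun _ => reflection_conj_mem_bilinGroup_inf_detOne h) hg

theorem isCompactSymmetricRealization_identityComponent (h : IsIsotropicPair S w w') :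
    IsCompactSymmetricRealization
      (identityComponent (bilinGroup (S : Matrix ι ι F) ⊓ detOne ι F))
      (stab _ (line w)) (stab _ (line w) ⊓ stab _ (line w')) :=
  isCompactSymmetricRealization_of_isIsotropicPair h
    (identityComponent_le.trans (inf_le_left.trans (bilinGroup_eq_formGroup S).le))
    (isOpen_identityComponent_bilinGroup_inf_detOne S)
    fun _ => reflection_conj_mem_identityComponent h

end Realization

section Real

variable {p q : ℕ}

theorem formI_mem_unitary : formI p q ℝ ∈ unitary (Matrix _ _ ℝ) := by
  simp [Unitary.mem_iff, formI, Matrix.star_eq_conjTranspose, Matrix.fromBlocks_transpose,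
    Matrix.fromBlocks_multiply]

theorem star_formI_mulVec_star_realIsotropic (c : ℝ) :
    star (formI (p + 1) (q + 1) ℝ) *ᵥ star (realIsotropic p q c) = realIsotropic p q (-c) := by
  rw [Matrix.star_eq_conjTranspose, formI, Matrix.fromBlocks_conjTranspose, realIsotropic,
    star_trivial, Matrix.fromBlocks_mulVec]
  simp [Matrix.neg_mulVec, realIsotropic, Pi.single_neg, -Matrix.mulVec_single]

theorem isIsotropicPair_realIsotropic :
    IsIsotropicPair ⟨formI (p + 1) (q + 1) ℝ, formI_mem_unitary⟩ (realIsotropic p q 1)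
      (realIsotropic p q (-1)) where
  ne_zero h := one_ne_zero (α := ℝ) <| by simpa [realIsotropic] using congrFun h (Sum.inl 0)
  conj_left := star_formI_mulVec_star_realIsotropic 1
  conj_right := by
    simpa only [neg_neg] using star_formI_mulVec_star_realIsotropic (p := p) (q := q) (-1)
  orthogonal := by simp [realIsotropic]

end Real

section Complex

variable {n : ℕ}

theorem star_complexIsotropic (c : ℂ) :
    star (complexIsotropic n c) = complexIsotropic n (star c) := by
  ext (i | i)
  · fin_cases i <;> simp [complexIsotropic]
  · simp [complexIsotropic]

theorem isIsotropicPair_complexIsotropic :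
    IsIsotropicPair (F := ℂ) ⟨1, one_mem _⟩ (complexIsotropic n Complex.I)
      (complexIsotropic n (-Complex.I)) where
  ne_zero h := one_ne_zero (α := ℂ) <| by simpa [complexIsotropic] using congrFun h (Sum.inl 0)
  conj_left := by simp [star_complexIsotropic]
  conj_right := by simp [star_complexIsotropic]
  orthogonal := by
    rw [star_complexIsotropic]
    simp [complexIsotropic, dotProduct]

end Complex

theorem isCompactSymmetricRealization_realQuadric (p q : ℕ) :
    IsCompactSymmetricRealization (SOIdComponent (p + 1) (q + 1)) (realQuadricParabolic p q)
      (realQuadricLevi p q) := by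
  have h := isCompactSymmetricRealization_identityComponent
    (isIsotropicPair_realIsotropic (p := p) (q := q))
  exact h

theorem isCompactSymmetricRealization_complexQuadric (n : ℕ) :
    IsCompactSymmetricRealization (SOComplex n) (complexQuadricParabolic n)
      (complexQuadricLevi n) := by
  have h := isCompactSymmetricRealization_bilinGroup_inf_detOne
    (isIsotropicPair_complexIsotropic (n := n))
  exact h

end Quadrics

section Columns

variable {ι F : Type*}

open MulOpposite

theorem sum_op_smul_col [Semiring F] {κ : Type*} [Fintype κ] (M : Matrix ι κ F) (c : κ → Fᵐᵒᵖ) :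
    ∑ i, c i • M.col i = M *ᵥ (unop ∘ c) := by
  ext a
  simp [Matrix.mulVec, dotProduct]

theorem coe_span_range_col [Semiring F] {κ : Type*} [Fintype κ] (M : Matrix ι κ F) :
    (Submodule.span Fᵐᵒᵖ (Set.range M.col) : Set (ι → F)) = Set.range (M *ᵥ ·) := by
  ext x
  rw [SetLike.mem_coe, Submodule.mem_span_range_iff_exists_fun]
  simp only [sum_op_smul_col]
  exact ⟨fun ⟨c, hc⟩ => ⟨unop ∘ c, hc⟩, fun ⟨y, hy⟩ => ⟨op ∘ y, hy⟩⟩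

variable [Fintype ι] [DecidableEq ι]

/-- The columns of an invertible matrix, as a basis of the right vector space of column vectors. -/
noncomputable def columnBasis [Ring F] (g : GLin ι F) : Module.Basis ι Fᵐᵒᵖ (ι → F) :=
  .ofEquivFun
    { toFun x := op ∘ (((g⁻¹ : GLin ι F) : Matrix ι ι F) *ᵥ x)
      invFun c := (g : Matrix ι ι F) *ᵥ (unop ∘ c)
      map_add' x y := by rw [Matrix.mulVec_add]; rfl
      map_smul' c x := by rw [Matrix.mulVec_smul]; rfl
      left_inv x := by
        change (g : Matrix ι ι F) *ᵥ (((g⁻¹ : GLin ι F) : Matrix ι ι F) *ᵥ x) = x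
        rw [Matrix.mulVec_mulVec, Units.mul_inv, Matrix.one_mulVec]
      right_inv c := by
        change op ∘ (((g⁻¹ : GLin ι F) : Matrix ι ι F) *ᵥ ((g : Matrix ι ι F) *ᵥ (unop ∘ c))) = c
        rw [Matrix.mulVec_mulVec, Units.inv_mul, Matrix.one_mulVec]
        rfl }

theorem columnBasis_apply [Ring F] (g : GLin ι F) (i : ι) :
    columnBasis g i = (g : Matrix ι ι F).col i := by
  rw [columnBasis, Module.Basis.coe_ofEquivFun]
  change (g : Matrix ι ι F) *ᵥ (unop ∘ Pi.single i 1) = _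
  rw [← Matrix.mulVec_single_one]
  congr 1
  ext j
  by_cases h : j = i <;> simp [h]

variable [DivisionRing F]

theorem exists_columnBasis_eq (b : Module.Basis ι Fᵐᵒᵖ (ι → F)) :
    ∃ g : GLin ι F, ⇑(columnBasis g) = b := by
  let M : Matrix ι ι F := .of fun i j => b j i
  let N : Matrix ι ι F := .of fun i j => unop (b.repr (Pi.single j 1) i)
  have hMN : M * N = 1 := by
    refine Matrix.ext_col fun j => ?_
    change M *ᵥ (unop ∘ b.repr (Pi.single j 1)) = (1 : Matrix ι ι F).col j
    rw [← sum_op_smul_col, ← Matrix.mulVec_single_one, Matrix.one_mulVec]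
    exact b.sum_repr _
  exact ⟨⟨M, N, hMN, mul_eq_one_comm.1 hMN⟩, funext fun j => columnBasis_apply _ j⟩

end Columns

section Dimension

variable {ι F : Type*}

theorem finite_mulOpposite_pi [Finite ι] [Ring F] : Module.Finite Fᵐᵒᵖ (ι → F) := by
  classical
  have := Fintype.ofFinite ι
  exact .of_basis (columnBasis 1)

theorem finrank_mulOpposite_pi [Fintype ι] [DivisionRing F] :
    Module.finrank Fᵐᵒᵖ (ι → F) = Fintype.card ι := by
  classical exact Module.finrank_eq_card_basis (columnBasis 1)

end Dimension

section Frames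

variable {p q : ℕ} {F : Type*}

theorem frameSpan_surjective [DivisionRing F] : Function.Surjective (frameSpan p q F) := by
  rintro ⟨W, hW⟩
  have := finite_mulOpposite_pi (ι := Fin p ⊕ Fin q) (F := F)
  let b := Module.finBasisOfFinrankEq Fᵐᵒᵖ W hW
  refine ⟨⟨W.subtype ∘ b, b.linearIndependent.map' _ W.ker_subtype⟩, Subtype.ext ?_⟩
  change Submodule.span Fᵐᵒᵖ (Set.range (W.subtype ∘ b)) = W
  rw [Set.range_comp, Submodule.span_image, b.span_eq, Submodule.map_top, Submodule.range_subtype]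

/-- The frame of the first `p` columns of an invertible matrix. -/
noncomputable def columnFrame [Ring F] (g : GLin (Fin p ⊕ Fin q) F) : Frames p q F :=
  ⟨fun i => (g : Matrix (Fin p ⊕ Fin q) (Fin p ⊕ Fin q) F).col (Sum.inl i), by
    have h := (columnBasis g).linearIndependent.comp Sum.inl Sum.inl_injective
    rwa [show columnBasis g ∘ Sum.inl = _ from funext fun i => columnBasis_apply g (Sum.inl i)]
      at h⟩

/-- The matrix obtained from `M` by replacing its first `p` columns by the vectors `v i`. -/
def replaceColumns (M : Matrix (Fin p ⊕ Fin q) (Fin p ⊕ Fin q) F)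
    (v : Fin p → Fin p ⊕ Fin q → F) : Matrix (Fin p ⊕ Fin q) (Fin p ⊕ Fin q) F :=
  .of fun a => Sum.elim (fun i => v i a) fun j => M a (Sum.inr j)

theorem replaceColumns_columnFrame [Ring F] (g : GLin (Fin p ⊕ Fin q) F) :
    replaceColumns (g : Matrix (Fin p ⊕ Fin q) (Fin p ⊕ Fin q) F) (columnFrame g).1 = g := by
  ext a (i | j) <;> rfl

theorem columnFrame_eq_of_coe_eq_replaceColumns [Ring F] {g : GLin (Fin p ⊕ Fin q) F}
    {M : Matrix (Fin p ⊕ Fin q) (Fin p ⊕ Fin q) F} {v : Frames p q F}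
    (hg : (g : Matrix (Fin p ⊕ Fin q) (Fin p ⊕ Fin q) F) = replaceColumns M v.1) :
    columnFrame g = v :=
  Subtype.ext <| funext fun i => congrArg (fun N => Matrix.col N (Sum.inl i)) hg

theorem columnFrame_surjective [DivisionRing F] :
    Function.Surjective (columnFrame : GLin (Fin p ⊕ Fin q) F → Frames p q F) := by
  rintro ⟨v, hv⟩
  have := finite_mulOpposite_pi (ι := Fin p ⊕ Fin q) (F := F)
  let b := Module.Basis.sumExtend hv
  have : Finite (Fin p ⊕ Module.Basis.sumExtendIndex hv) := Module.Finite.finite_basis b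
  have : Finite (Module.Basis.sumExtendIndex hv) := Finite.sum_right (Fin p)
  have := Fintype.ofFinite (Module.Basis.sumExtendIndex hv)
  have hcard : Fintype.card (Module.Basis.sumExtendIndex hv) = q := by
    have h := (Module.finrank_eq_card_basis b).symm.trans finrank_mulOpposite_pi
    simpa using h
  obtain ⟨g, hg⟩ := exists_columnBasis_eq
    (b.reindex ((Equiv.refl _).sumCongr (Fintype.equivFinOfCardEq hcard)))
  refine ⟨g, Subtype.ext (funext fun i => ?_)⟩
  change (g : Matrix (Fin p ⊕ Fin q) (Fin p ⊕ Fin q) F).col (Sum.inl i) = v i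
  rw [← columnBasis_apply, hg]
  simp only [b, Module.Basis.reindex_apply, Module.Basis.sumExtend, Module.Basis.extend_apply_self]
  rfl

theorem submatrix_inl_mulVec [Ring F] (M : Matrix (Fin p ⊕ Fin q) (Fin p ⊕ Fin q) F)
    (y : Fin p → F) : M.submatrix id Sum.inl *ᵥ y = M *ᵥ Sum.elim y 0 := by
  ext a
  simp [Matrix.mulVec, dotProduct]

theorem range_sumElim_zero [Ring F] :
    Set.range (fun y : Fin p → F => Sum.elim y 0) = stdFirst p q F := by
  ext x
  rw [mem_stdFirst_iff, blockProj_mulVec]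
  exact ⟨fun ⟨y, hy⟩ => by rw [← hy, Sum.elim_comp_inl], fun h => ⟨_, h⟩⟩

theorem coe_frameSpan_columnFrame [DivisionRing F] (g : GLin (Fin p ⊕ Fin q) F) :
    ((frameSpan p q F (columnFrame g)).1 : Set (Fin p ⊕ Fin q → F)) =
      (fun x => (g : Matrix (Fin p ⊕ Fin q) (Fin p ⊕ Fin q) F) *ᵥ x) '' stdFirst p q F := by
  let M : Matrix (Fin p ⊕ Fin q) (Fin p ⊕ Fin q) F := g
  calc ((frameSpan p q F (columnFrame g)).1 : Set (Fin p ⊕ Fin q → F))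
      = Set.range (M.submatrix id Sum.inl *ᵥ ·) := coe_span_range_col (M.submatrix id Sum.inl)
    _ = (M *ᵥ ·) '' stdFirst p q F := by
        simp only [submatrix_inl_mulVec, ← range_sumElim_zero, ← Set.range_comp]
        rfl

theorem image_mulVec_eq_image_iff [Ring F] {ι : Type*} [Fintype ι] [DecidableEq ι] {g h : GLin ι F}
    {W : Set (ι → F)} :
    (fun x => (g : Matrix ι ι F) *ᵥ x) '' W = (fun x => (h : Matrix ι ι F) *ᵥ x) '' W ↔
      (⟨g⁻¹ * h, Subgroup.mem_top _⟩ : (⊤ : Subgroup (GLin ι F))) ∈ stab ⊤ W := by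
  have hinv (g : GLin ι F) (x : ι → F) :
      ((g⁻¹ : GLin ι F) : Matrix ι ι F) *ᵥ ((g : Matrix ι ι F) *ᵥ x) = x := by
    rw [Matrix.mulVec_mulVec, Units.inv_mul, Matrix.one_mulVec]
  have himage (g : GLin ι F) : (fun x => (g : Matrix ι ι F) *ᵥ x) '' W =
      (fun x => ((g⁻¹ : GLin ι F) : Matrix ι ι F) *ᵥ x) ⁻¹' W :=
    congrFun (Set.image_eq_preimage_of_inverse (hinv g)
      (fun x => by simpa only [inv_inv] using hinv g⁻¹ x)) W
  have hsurj : Function.Surjective fun x => (h : Matrix ι ι F) *ᵥ x :=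
    fun x => ⟨_, by simpa only [inv_inv] using hinv h⁻¹ x⟩
  rw [himage, himage, Set.ext_iff, hsurj.forall]
  simp only [Set.mem_preimage, hinv, Matrix.mulVec_mulVec]
  rfl

theorem frameSpan_columnFrame_eq_iff [DivisionRing F] {g h : GLin (Fin p ⊕ Fin q) F} :
    frameSpan p q F (columnFrame g) = frameSpan p q F (columnFrame h) ↔
      g⁻¹ * h ∈ parabolic (blockProj p q F) := by
  refine Subtype.ext_iff.trans (SetLike.coe_set_eq.symm.trans ?_)
  rw [coe_frameSpan_columnFrame, coe_frameSpan_columnFrame, image_mulVec_eq_image_iff,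
    stab_eq_parabolic_subgroupOf isIdempotentElem_blockProj _ mem_stdFirst_iff]
  rfl

end Frames

section UnitaryGroups

variable {F : Type*} [Ring F] [StarRing F]

theorem mem_unitaryGL_iff {ι : Type*} [Fintype ι] [DecidableEq ι] {g : GLin ι F} :
    g ∈ unitaryGL ι F ↔ g ∈ unitaryUnits (Matrix ι ι F) := by
  change star (g : Matrix ι ι F) * 1 * g = 1 ↔ (g : Matrix ι ι F) ∈ unitary _
  rw [mul_one, Unitary.mem_iff]
  refine ⟨fun h => ⟨h, ?_⟩, And.left⟩
  rw [← Units.inv_eq_of_mul_eq_one_left h, Units.mul_inv]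

variable {p q : ℕ}

theorem mem_blockUnitary_iff {g : unitaryGL (Fin p ⊕ Fin q) F} :
    g ∈ blockUnitary p q F ↔ Commute (mat g) (blockProj p q F) := by
  constructor
  · rintro ⟨a, d, h⟩
    rw [h]
    simp [Commute, SemiconjBy, blockProj, Matrix.fromBlocks_multiply]
  · intro hcomm
    obtain ⟨A, B, C, D, hM⟩ : ∃ A B C D, mat g = Matrix.fromBlocks A B C D :=
      ⟨_, _, _, _, (Matrix.fromBlocks_toBlocks (mat g)).symm⟩
    obtain ⟨hB, hC⟩ : B = 0 ∧ C = 0 := by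
      have h := hcomm.eq
      simp only [hM, blockProj, Matrix.fromBlocks_multiply, Matrix.fromBlocks_inj, mul_zero,
        mul_one, zero_mul, one_mul, Matrix.mul_zero, Matrix.mul_one, Matrix.zero_mul,
        Matrix.one_mul, add_zero] at h
      exact ⟨h.2.1.symm, h.2.2.1⟩
    subst hB hC
    have hunitary : mat g ∈ unitary (Matrix (Fin p ⊕ Fin q) (Fin p ⊕ Fin q) F) :=
      mem_unitaryGL_iff.1 g.2
    simp only [Unitary.mem_iff, hM, Matrix.star_eq_conjTranspose,
      Matrix.fromBlocks_conjTranspose, Matrix.fromBlocks_multiply, Matrix.conjTranspose_zero,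
      Matrix.mul_zero, Matrix.zero_mul, add_zero, zero_add, ← Matrix.fromBlocks_one,
      Matrix.fromBlocks_inj, true_and] at hunitary
    obtain ⟨⟨hA, hD⟩, hA', hD'⟩ := hunitary
    exact ⟨⟨⟨A, Aᴴ, hA', hA⟩, mem_unitaryGL_iff.2 ⟨hA, hA'⟩⟩,
      ⟨⟨D, Dᴴ, hD', hD⟩, mem_unitaryGL_iff.2 ⟨hD, hD'⟩⟩, hM⟩

end UnitaryGroups

section Grassmannian

variable {p q : ℕ} {F : Type*}

theorem isInducing_mat_unitaryGL [NormedRing F] [StarRing F] [ContinuousStar F]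
    {ι : Type*} [Fintype ι] [DecidableEq ι] :
    IsInducing (mat : unitaryGL ι F → Matrix ι ι F) :=
  isInducing_val_of_mem_unitaryUnits IsInducing.subtypeVal fun k => mem_unitaryGL_iff.1 k.2

theorem mk_eq_mk_iff_frameSpan_columnFrame_eq [DivisionRing F] [StarRing F]
    {k k' : unitaryGL (Fin p ⊕ Fin q) F} :
    (k : unitaryGL (Fin p ⊕ Fin q) F ⧸ blockUnitary p q F) = k' ↔
      frameSpan p q F (columnFrame k) = frameSpan p q F (columnFrame k') := by
  rw [QuotientGroup.eq, mem_blockUnitary_iff, frameSpan_columnFrame_eq_iff]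
  exact (mem_parabolic_iff_commute isStarProjection_blockProj
    (mem_unitaryGL_iff.1 (k⁻¹ * k').2)).symm

attribute [local instance] Matrix.normedAddCommGroup Matrix.normedSpace

theorem contDiff_replaceColumns [NormedRing F] [NormedAlgebra ℝ F]
    (M : Matrix (Fin p ⊕ Fin q) (Fin p ⊕ Fin q) F) : ContDiff ℝ ∞ (replaceColumns M) := by
  refine contDiff_pi.2 fun a => contDiff_pi.2 fun b => ?_
  rcases b with i | j
  · exact contDiff_apply_apply ℝ F i a
  · exact contDiff_const

variable [NormedDivisionRing F] [NormedAlgebra ℝ F] [StarRing F] [StarModule ℝ F]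
  [ContinuousStar F] [FiniteDimensional ℝ F] [ConjugationAlgebra F]

theorem exists_contDiffAt_unitary_section_frameSpan (v₀ : Frames p q F) :
    ∃ κ : (Fin p → Fin p ⊕ Fin q → F) → Matrix (Fin p ⊕ Fin q) (Fin p ⊕ Fin q) F,
      ContDiffAt ℝ ∞ κ v₀.1 ∧ ∀ᶠ w in 𝓝 v₀.1, ∀ v : Frames p q F, v.1 = w →
        ∃ k : unitaryGL (Fin p ⊕ Fin q) F, mat k = κ w ∧
          frameSpan p q F (columnFrame k) = frameSpan p q F v := by
  obtain ⟨g₀, rfl⟩ := columnFrame_surjective v₀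
  have hpair : IsOppositePair ∅ (blockProj p q F) (1 - blockProj p q F) :=
    isOppositePair_one_sub isStarProjection_blockProj fun τ hτ => absurd hτ (Finset.notMem_empty τ)
  obtain ⟨κ, hκ, hκ_sec⟩ := exists_contDiffAt_unitary_section_of_mem (G := ⊤) hpair
    formGroup_empty.ge (by simp) (Subgroup.mem_top g₀)
  have hunit := eventually_isUnit_matrix g₀
  have hsmooth := contDiff_replaceColumns (g₀ : Matrix (Fin p ⊕ Fin q) (Fin p ⊕ Fin q) F)
  rw [← replaceColumns_columnFrame g₀] at hκ hκ_sec hunit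
  refine ⟨fun w => κ (replaceColumns g₀ w), hκ.comp _ hsmooth.contDiffAt, ?_⟩
  filter_upwards [hsmooth.continuous.continuousAt.eventually hκ_sec,
    hsmooth.continuous.continuousAt.eventually hunit] with w hw ⟨g, hg⟩ v hv
  subst hv
  obtain ⟨k, -, hk, hkM, hkP⟩ := hw g (Subgroup.mem_top g) hg
  refine ⟨⟨k, mem_unitaryGL_iff.2 hk⟩, hkM, ?_⟩
  rw [← columnFrame_eq_of_coe_eq_replaceColumns hg]
  exact frameSpan_columnFrame_eq_iff.2 hkP

theorem isGrassmannRealization (p q : ℕ) : IsGrassmannRealization p q F := by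
  let _ : TopologicalSpace (Frames p q F) := .induced Subtype.val inferInstance
  let firstColumns (M : Matrix (Fin p ⊕ Fin q) (Fin p ⊕ Fin q) F) :
      Fin p → Fin p ⊕ Fin q → F := fun i => M.col (Sum.inl i)
  have hsmooth : ContDiff ℝ ∞ firstColumns :=
    contDiff_pi.2 fun i => contDiff_pi.2 fun a => contDiff_apply_apply ℝ F a (Sum.inl i)
  have hcont : Continuous fun k : unitaryGL (Fin p ⊕ Fin q) F => columnFrame k.1 := by
    rw [continuous_induced_rng]
    exact hsmooth.continuous.comp continuous_mat
  obtain ⟨φ, hφ, hdiffeo⟩ := exists_isDiffeo_of_local_sections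
    (π₂ := frameSpan p q F) isInducing_mat_unitaryGL continuous_induced_dom Subtype.val_injective
    (QuotientGroup.isQuotientMap_mk (blockUnitary p q F)) ⟨⟨rfl⟩, frameSpan_surjective⟩ hcont
    hsmooth (fun _ => rfl) (fun _ _ => mk_eq_mk_iff_frameSpan_columnFrame_eq)
    exists_contDiffAt_unitary_section_frameSpan
  refine ⟨φ, fun k => ?_, hdiffeo⟩
  rw [hφ]
  exact coe_frameSpan_columnFrame _

end Grassmannian

end Grassmann

open Grassmann in
theorem mainTheorem12_general :
    (∀ (F : Type*) [NormedDivisionRing F] [NormedAlgebra ℝ F] [StarRing F] [StarModule ℝ F]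
      [ContinuousStar F] [FiniteDimensional ℝ F] [ConjugationAlgebra F],
      (∀ p q : ℕ, IsBlockRealization (F := F) (⊤ : Subgroup (GLin (Fin p ⊕ Fin q) F)) ∧
        IsGrassmannRealization p q F) ∧
      ∀ n : ℕ, IsBlockRealization (F := F) (sesqGroup (formD n F)) ∧
        IsBlockRealization (F := F) (sesqGroup (formJ n F))) ∧
    (∀ (F : Type*) [RCLike F] (n : ℕ), IsBlockRealization (F := F) (bilinGroup (formJ n F)) ∧
      IsBlockRealization (F := F) (bilinGroup (formD n F)) ∧
      IsBlockRealization (F := F) (bilinGroup (formD n F) ⊓ detOne (Fin n ⊕ Fin n) F)) ∧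
    (∀ p q : ℕ, IsCompactSymmetricRealization (SOIdComponent (p + 1) (q + 1))
      (realQuadricParabolic p q) (realQuadricLevi p q)) ∧
    ∀ n : ℕ, IsCompactSymmetricRealization (SOComplex n)
      (complexQuadricParabolic n) (complexQuadricLevi n) :=
  ⟨fun _ => ⟨fun p q => ⟨isBlockRealization_top p q, isGrassmannRealization p q⟩, fun _ =>
      ⟨isBlockRealization_sesqGroup formD_mem_unitary star_formD_mul_blockProj_mul_formD,
        isBlockRealization_sesqGroup formJ_mem_unitary star_formJ_mul_blockProj_mul_formJ⟩⟩,
    fun _ _ _ =>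
      ⟨isBlockRealization_bilinGroup formJ_mem_unitary star_formJ_mul_blockProj_mul_formJ,
        isBlockRealization_bilinGroup formD_mem_unitary star_formD_mul_blockProj_mul_formD,
        isBlockRealization_bilinGroup_inf_detOne formD_mem_unitary
          star_formD_mul_blockProj_mul_formD⟩,
    isCompactSymmetricRealization_realQuadric, isCompactSymmetricRealization_complexQuadric⟩

theorem mainTheorem12 :
    -- ordinary Grassmannians: `GL(p+q, F)`
    (∀ p q : ℕ,
      (Grassmann.IsBlockRealization (⊤ : Subgroup (Grassmann.GLin (Fin p ⊕ Fin q) ℝ)) ∧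
        Grassmann.IsGrassmannRealization p q ℝ) ∧
      (Grassmann.IsBlockRealization (⊤ : Subgroup (Grassmann.GLin (Fin p ⊕ Fin q) ℂ)) ∧
        Grassmann.IsGrassmannRealization p q ℂ) ∧
      (Grassmann.IsBlockRealization (⊤ : Subgroup (Grassmann.GLin (Fin p ⊕ Fin q) ℍ[ℝ])) ∧
        Grassmann.IsGrassmannRealization p q ℍ[ℝ])) ∧
    -- symplectic Lagrangian Grassmannians: `Sp(2n, F)`
    (∀ n : ℕ,
      Grassmann.IsBlockRealization (F := ℝ) (Grassmann.bilinGroup (Grassmann.formJ n ℝ)) ∧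
      Grassmann.IsBlockRealization (F := ℂ) (Grassmann.bilinGroup (Grassmann.formJ n ℂ))) ∧
    -- orthogonal Lagrangian Grassmannians: `O(2n, ℂ)` and `SO(2n, ℂ)`
    (∀ n : ℕ,
      Grassmann.IsBlockRealization (F := ℂ) (Grassmann.bilinGroup (Grassmann.formD n ℂ)) ∧
      Grassmann.IsBlockRealization (F := ℂ)
        (Grassmann.bilinGroup (Grassmann.formD n ℂ) ⊓ Grassmann.detOne (Fin n ⊕ Fin n) ℂ)) ∧
    -- Hermitian Lagrangian Grassmannians: `U(n, n; F)`
    (∀ n : ℕ,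
      Grassmann.IsBlockRealization (F := ℝ) (Grassmann.sesqGroup (Grassmann.formD n ℝ)) ∧
      Grassmann.IsBlockRealization (F := ℂ) (Grassmann.sesqGroup (Grassmann.formD n ℂ)) ∧
      Grassmann.IsBlockRealization (F := ℍ[ℝ]) (Grassmann.sesqGroup (Grassmann.formD n ℍ[ℝ]))) ∧
    -- skew Hermitian quaternionic Lagrangian Grassmannians: `SO^*(4n)`
    (∀ n : ℕ,
      Grassmann.IsBlockRealization (F := ℍ[ℝ]) (Grassmann.sesqGroup (Grassmann.formJ n ℍ[ℝ]))) ∧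
    -- real quadrics: `SO(p+1, q+1)_e`
    (∀ p q : ℕ, 2 < p + q →
      Grassmann.IsCompactSymmetricRealization (Grassmann.SOIdComponent (p + 1) (q + 1))
        (Grassmann.realQuadricParabolic p q) (Grassmann.realQuadricLevi p q)) ∧
    -- complex quadrics: `SO(n+2, ℂ)`
    (∀ n : ℕ, 3 ≤ n →
      Grassmann.IsCompactSymmetricRealization (Grassmann.SOComplex n)
        (Grassmann.complexQuadricParabolic n) (Grassmann.complexQuadricLevi n)) := by
  obtain ⟨hdiv, hbilin, hreal, hcomplex⟩ := mainTheorem12_general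
  exact ⟨fun p q => ⟨(hdiv ℝ).1 p q, (hdiv ℂ).1 p q, (hdiv ℍ[ℝ]).1 p q⟩,
    fun n => ⟨(hbilin ℝ n).1, (hbilin ℂ n).1⟩, fun n => (hbilin ℂ n).2,
    fun n => ⟨((hdiv ℝ).2 n).1, ((hdiv ℂ).2 n).1, ((hdiv ℍ[ℝ]).2 n).1⟩,
    fun n => ((hdiv ℍ[ℝ]).2 n).2, fun p q _ => hreal p q, fun n _ => hcomplex n⟩
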